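/- All graphs are finite, simple and undirected. For a graph $G$ let $\lambda(G)$ be the largest eigenvalue of its adjacency matrix, and for an integer $s\ge 2$ let $js_s(G)$ be the maximum number of $s$-cliques of $G$ that all contain one common edge of $G$ (with $js_s(G)=0$ if $G$ has no edges). Let $r\ge 1$ be an integer. (i) There is a constant $c>0$ depending only on $r$ such that every graph $G$ with $m$ edges and $$\lambda(G)^2>\Bigl(1-\frac1r\Bigr)2m$$ satisfies $$js_{r+1}(G)\ \ge\ c\,m^{\frac{r-1}{2}};$$ that is, some edge of $G$ lies in at least $c\,m^{(r-1)/2}$ copies of $K_{r+1}$. (ii) This bound is tight up to a constant factor: there are constants $C>0$ and $m_0$ depending only on $r$ such that for every integer $m\ge m_0$ there is a graph $G$ with exactly $m$ edges, with $\lambda(G)^2>\bigl(1-\frac1r\bigr)2m$, and with $$js_{r+1}(G)\ \le\ C\,m^{\frac{r-1}{2}}.$$ -/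

import Mathlib

namespace SimpleGraph

open Classical in
/-- The spectral radius `λ(G)` of a finite graph: the largest eigenvalue of its (real symmetric)
adjacency matrix. It is `0` for the graph without vertices. -/
noncomputable def largestEigenvalue {V : Type*} [Fintype V] (G : SimpleGraph V) : ℝ :=
  ⨆ i : V, (G.isHermitian_adjMatrix ℝ).eigenvalues i

/-- A family `F` of vertex sets is an `s`-joint of `G` if its members are `s`-cliques of `G` that
all contain a common edge `uv` of `G`. -/
def IsJoint {V : Type*} (G : SimpleGraph V) (s : ℕ) (F : Finset (Finset V)) : Prop :=
  ∃ u v : V, G.Adj u v ∧ ∀ K ∈ F, G.IsNClique s K ∧ u ∈ K ∧ v ∈ K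

open Classical in
/-- The joint size `js_s(G)`: the maximum number of `s`-cliques in an `s`-joint of `G`
(`0` if `G` has no edges). -/
noncomputable def jointSize {V : Type*} [Fintype V] (G : SimpleGraph V) (s : ℕ) : ℕ :=
  (Finset.univ.filter fun F : Finset (Finset V) => G.IsJoint s F).sup Finset.card

end SimpleGraph

/-!
Write `λ` for the largest eigenvalue, `m` for the number of edges, `x` for the Perron vector and
`y v = x v ^ 2`, a probability distribution on the vertices.

*Lower bound, `r ≥ 2`.* Cauchy–Schwarz on the edges turns `λ² > (1 - 1/r) 2m` into the statement
that the `y`-weighted edge density exceeds `1 - 1/r`, so a `K_{r+1}` exists by Motzkin–Straus. To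
find an edge in many cliques, pass to a subgraph `H` maximizing `λ² / m^α` with `α < 1` close to `1`
(`exists_isEdgeCritical`). As `λ² ≤ 2m` always, `H` keeps a positive fraction of the edges and stays
above the threshold. Its extremality gives two facts.

* Deleting an edge `uv` does not help, so `x u * x v ≥ 1 / (8 √m)` for every edge
  (`IsEdgeCritical.le_mul_of_adj`).
* Deleting a vertex `v` does not help, so `deg v` is at most about `2 m y v`
  (`IsEdgeCritical.degree_le`). Combined with Cauchy–Schwarz in the eigenvalue equation at `v`, the
  neighbourhood of `v` has `y`-weight at least about `1 - 1/r`. This remains true for the *light*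
  neighbours `w`, those with `x v * x w ≤ L / √m`, because the heavy ones contribute at most
  `x v √m / L` to the eigenvalue equation (`IsEdgeCritical.le_sum_sq_lightNeighbors`).

The weighted degree estimate degrades when `y v` is not small. For `r ≥ 3` and large `m` such
vertices do not occur (`IsCriticalSetup.sq_le_of_three_le`); for `r = 2` the weaker estimate
`(8/9) (1 - 1/r)` suffices.

Now take a `K_{r+1}` in `H`. A convexity count of the points by the number of light neighbourhoods
of its vertices containing them (`exists_pair_le_sum_inter`) yields an edge `uv` of the clique whose
light codegree is at least `1 - 2/r + ε`. Every common light neighbour `w` of `u` and `v` has weight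
`y w = O(1 / √m)`, since `x u * x v` is not small. Hence each clique on at most `r - 2` vertices in
this common neighbourhood has extensions of total weight bounded below, that is, at least `c √m`
extensions, and greedy counting produces `c' m^((r-1)/2)` cliques `K_{r-1}` completing `uv`.

*Tightness.* Any two vertices lie in at most `n^(r-1)` sets of `r + 1` vertices, so it is enough to
have a graph above the threshold on `n = O(√m)` vertices. An `m`-edge subgraph of the smallest
possible complete graph is one, as `λ` is at least the average degree.
-/

namespace SimpleGraph

open Finset Matrix

/-! ### The adjacency form and the Perron vector -/

open Classical in
/-- The quadratic form `zᵀ A z` of the adjacency matrix `A` of `G`, as a sum over ordered pairs: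
every edge contributes twice. -/
noncomputable def adjForm {V : Type*} [Fintype V] (G : SimpleGraph V) (z : V → ℝ) : ℝ :=
  ∑ u, ∑ w, if G.Adj u w then z u * z w else 0

/-- `x` is a nonnegative unit eigenvector of the adjacency matrix for the largest eigenvalue. -/
structure IsPerronVector {V : Type*} [Fintype V] (G : SimpleGraph V) (x : V → ℝ) : Prop where
  nonneg : ∀ v, 0 ≤ x v
  sum_sq : ∑ v, x v ^ 2 = 1
  sum_adj : open Classical in
    ∀ v, ∑ w, (if G.Adj v w then x w else 0) = G.largestEigenvalue * x v

variable {V : Type*} [Fintype V] (G : SimpleGraph V)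

open Classical in
theorem adjForm_eq_dotProduct (z : V → ℝ) : G.adjForm z = z ⬝ᵥ (G.adjMatrix ℝ *ᵥ z) := by
  simp only [adjForm, dotProduct, mulVec, adjMatrix_apply, Finset.mul_sum]
  refine sum_congr rfl fun u _ => sum_congr rfl fun w _ => ?_
  split_ifs <;> simp

open Classical in
theorem adjForm_eq_sum_mul (z : V → ℝ) :
    G.adjForm z = ∑ u, z u * ∑ w, (if G.Adj u w then z w else 0) := by
  simp only [adjForm, Finset.mul_sum, mul_ite, mul_zero]

open Classical in
theorem posSemidef_largestEigenvalue_sub :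
    (G.largestEigenvalue • (1 : Matrix V V ℝ) - G.adjMatrix ℝ).PosSemidef := by
  set hA := G.isHermitian_adjMatrix ℝ
  have hU : (hA.eigenvectorUnitary : Matrix V V ℝ) * (hA.eigenvectorUnitary : Matrix V V ℝ)ᴴ = 1 :=
    Unitary.mul_star_self_of_mem hA.eigenvectorUnitary.2
  have hspec := hA.spectral_theorem
  rw [Unitary.conjStarAlgAut_apply] at hspec
  have key : G.largestEigenvalue • (1 : Matrix V V ℝ) - G.adjMatrix ℝ =
      (hA.eigenvectorUnitary : Matrix V V ℝ) *
        diagonal (fun i => G.largestEigenvalue - hA.eigenvalues i) *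
        (hA.eigenvectorUnitary : Matrix V V ℝ)ᴴ := by
    have : diagonal (fun i => G.largestEigenvalue - hA.eigenvalues i) =
        G.largestEigenvalue • (1 : Matrix V V ℝ) - diagonal hA.eigenvalues := by
      ext i j
      by_cases h : i = j
      · subst h; simp
      · simp [h]
    rw [this, Matrix.mul_sub, Matrix.sub_mul, Matrix.mul_smul, Matrix.mul_one, Matrix.smul_mul, hU]
    congr 1
  rw [key]
  refine PosSemidef.mul_mul_conjTranspose_same (posSemidef_diagonal_iff.2 fun i => ?_) _
  exact sub_nonneg.2 (le_ciSup (f := fun i => hA.eigenvalues i) (Set.finite_range _).bddAbove i)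

/-- The Rayleigh bound `zᵀ A z ≤ λ ‖z‖²`. -/
theorem adjForm_le (z : V → ℝ) : G.adjForm z ≤ G.largestEigenvalue * ∑ v, z v ^ 2 := by
  classical
  have h := (G.posSemidef_largestEigenvalue_sub).dotProduct_mulVec_nonneg z
  rw [sub_mulVec, smul_mulVec, one_mulVec, dotProduct_sub, dotProduct_smul] at h
  rw [adjForm_eq_dotProduct]
  have h2 : star z ⬝ᵥ z = ∑ v, z v ^ 2 := by simp [dotProduct, sq]
  rw [h2, star_trivial, smul_eq_mul] at h
  linarith

/-- If `z` attains the maximum of the Rayleigh quotient, then it is an eigenvector. -/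
theorem sum_adj_eq_of_adjForm_ge {z : V → ℝ}
    (hz : G.largestEigenvalue * ∑ v, z v ^ 2 ≤ G.adjForm z) :
    open Classical in
    ∀ v, ∑ w, (if G.Adj v w then z w else 0) = G.largestEigenvalue * z v := by
  classical
  intro v
  have h0 : star z ⬝ᵥ ((G.largestEigenvalue • (1 : Matrix V V ℝ) - G.adjMatrix ℝ) *ᵥ z) = 0 := by
    rw [sub_mulVec, smul_mulVec, one_mulVec, dotProduct_sub, dotProduct_smul, star_trivial,
      ← adjForm_eq_dotProduct]
    have h2 : z ⬝ᵥ z = ∑ v, z v ^ 2 := by simp [dotProduct, sq]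
    rw [h2, smul_eq_mul, le_antisymm hz (G.adjForm_le z), sub_self]
  rw [G.posSemidef_largestEigenvalue_sub.dotProduct_mulVec_zero_iff] at h0
  have h1 := congrFun h0 v
  rw [sub_mulVec, smul_mulVec, one_mulVec] at h1
  simp only [Pi.sub_apply, Pi.smul_apply, smul_eq_mul, Pi.zero_apply, mulVec, dotProduct,
    adjMatrix_apply, ite_mul, one_mul, zero_mul] at h1
  linarith

theorem exists_isPerronVector [Nonempty V] : ∃ x, G.IsPerronVector x := by
  classical
  set hA := G.isHermitian_adjMatrix ℝ
  obtain ⟨i, hi⟩ := exists_eq_ciSup_of_finite (f := fun i => hA.eigenvalues i)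
  have hi : hA.eigenvalues i = G.largestEigenvalue := hi
  set b : V → ℝ := ⇑(hA.eigenvectorBasis i)
  have hb : G.adjMatrix ℝ *ᵥ b = G.largestEigenvalue • b := by
    rw [← hi]; exact hA.mulVec_eigenvectorBasis i
  have hn : ∑ v, b v ^ 2 = 1 := by
    have := hA.eigenvectorBasis.norm_eq_one i
    rw [EuclideanSpace.norm_eq, Real.sqrt_eq_one] at this
    simpa using this
  have hn' : ∑ v, |b v| ^ 2 = 1 := by simpa using hn
  refine ⟨fun v => |b v|, fun v => abs_nonneg _, hn', ?_⟩
  -- replacing the entries by their absolute values does not decrease the Rayleigh quotient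
  refine G.sum_adj_eq_of_adjForm_ge ?_
  rw [hn', mul_one]
  have h1 : G.adjForm b = G.largestEigenvalue := by
    rw [adjForm_eq_dotProduct, hb, dotProduct_smul]
    have h2 : b ⬝ᵥ b = ∑ v, b v ^ 2 := by simp [dotProduct, sq]
    rw [h2, hn]; simp
  rw [← h1]
  refine sum_le_sum fun u _ => sum_le_sum fun w _ => ?_
  split_ifs
  · rw [← abs_mul]; exact le_abs_self _
  · exact le_rfl

open Classical in
theorem sum_adj_one_eq_degree (v : V) : ∑ w, (if G.Adj v w then (1 : ℝ) else 0) = G.degree v := by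
  rw [sum_boole, ← card_neighborFinset_eq_degree, neighborFinset_eq_filter]

theorem sum_sum_adj_one :
    open Classical in
    ∑ u, ∑ w, (if G.Adj u w then (1 : ℝ) else 0) = 2 * G.edgeSet.ncard := by
  classical
  simp_rw [sum_adj_one_eq_degree]
  rw [← Nat.cast_sum, sum_degrees_eq_twice_card_edges, ← coe_edgeFinset, Set.ncard_coe_finset]
  push_cast; rfl

/-- Cauchy–Schwarz on the edges: the weights `z v ^ 2` have density at least `(zᵀ A z)² / 2m`. -/
theorem adjForm_sq_le (z : V → ℝ) :
    G.adjForm z ^ 2 ≤ 2 * G.edgeSet.ncard * G.adjForm (fun v => z v ^ 2) := by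
  classical
  have h := sum_mul_sq_le_sq_mul_sq (univ : Finset (V × V))
    (fun p => if G.Adj p.1 p.2 then (1 : ℝ) else 0)
    (fun p => if G.Adj p.1 p.2 then z p.1 * z p.2 else 0)
  rw [← univ_product_univ, sum_product, sum_product, sum_product] at h
  rw [← sum_sum_adj_one, adjForm, adjForm]
  simpa only [ite_mul, ite_pow, one_mul, zero_mul, one_pow, mul_pow, ne_eq, OfNat.ofNat_ne_zero,
    not_false_eq_true, zero_pow, ← ite_and, and_self] using h

theorem adjForm_le_sum_sq {y : V → ℝ} (hy : ∀ v, 0 ≤ y v) : G.adjForm y ≤ (∑ v, y v) ^ 2 := by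
  classical
  rw [sq, sum_mul_sum]
  refine sum_le_sum fun u _ => sum_le_sum fun w _ => ?_
  split_ifs
  · exact le_rfl
  · exact mul_nonneg (hy u) (hy w)

variable {G} in
theorem adjForm_nonneg {z : V → ℝ} (hz : ∀ v, 0 ≤ z v) : 0 ≤ G.adjForm z := by
  classical
  refine sum_nonneg fun u _ => sum_nonneg fun w _ => ?_
  split_ifs
  · exact mul_nonneg (hz u) (hz w)
  · exact le_rfl

theorem largestEigenvalue_nonneg : 0 ≤ G.largestEigenvalue := by
  classical
  rcases isEmpty_or_nonempty V with h | ⟨⟨v⟩⟩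
  · simp [largestEigenvalue]
  · have := G.adjForm_le (Pi.single v 1)
    have h1 : ∑ w, (Pi.single v (1 : ℝ) : V → ℝ) w ^ 2 = 1 := by
      simp [Pi.single_apply]
    have h2 : 0 ≤ G.adjForm (Pi.single v (1 : ℝ)) :=
      adjForm_nonneg fun w => by rw [Pi.single_apply]; split_ifs <;> norm_num
    rw [h1] at this; linarith

variable {G} in
theorem IsPerronVector.adjForm_eq {x : V → ℝ} (hx : G.IsPerronVector x) :
    G.adjForm x = G.largestEigenvalue := by
  classical
  rw [adjForm_eq_sum_mul]
  simp_rw [hx.sum_adj]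
  calc ∑ u, x u * (G.largestEigenvalue * x u) = G.largestEigenvalue * ∑ u, x u ^ 2 := by
        rw [mul_sum]; exact sum_congr rfl fun u _ => by ring
    _ = _ := by rw [hx.sum_sq, mul_one]

theorem largestEigenvalue_sq_le : G.largestEigenvalue ^ 2 ≤ 2 * G.edgeSet.ncard := by
  rcases isEmpty_or_nonempty V with h | h
  · simp [largestEigenvalue]
  · obtain ⟨x, hx⟩ := G.exists_isPerronVector
    have h1 := G.adjForm_sq_le x
    rw [hx.adjForm_eq] at h1
    have h2 := G.adjForm_le_sum_sq (y := fun v => x v ^ 2) fun v => sq_nonneg _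
    rw [hx.sum_sq, one_pow] at h2
    exact h1.trans (mul_le_of_le_one_right (by positivity) h2)

/-! ### Joint sizes -/

theorem IsJoint.card_le_jointSize {V : Type*} [Fintype V] {G : SimpleGraph V} {s : ℕ}
    {F : Finset (Finset V)} (hF : G.IsJoint s F) : F.card ≤ G.jointSize s := by
  classical
  exact le_sup (f := Finset.card) (mem_filter.2 ⟨mem_univ _, hF⟩)

theorem jointSize_succ_le {V : Type*} [Fintype V] (G : SimpleGraph V) {r : ℕ} (hr : 1 ≤ r) :
    G.jointSize (r + 1) ≤ Fintype.card V ^ (r - 1) := by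
  classical
  refine Finset.sup_le fun F hF => ?_
  obtain ⟨u, v, huv, hK⟩ := (mem_filter.1 hF).2
  have hcard : F.card ≤ ((univ : Finset V).powersetCard (r - 1)).card := by
    refine card_le_card_of_injOn (fun K => (K.erase u).erase v) ?_ ?_
    · intro K hKF
      obtain ⟨hc, hu, hv⟩ := hK K hKF
      rw [mem_coe, mem_powersetCard_univ, card_erase_of_mem (mem_erase.2 ⟨huv.ne', hv⟩),
        card_erase_of_mem hu, hc.card_eq]
      omega
    · intro K hKF K' hKF' h
      obtain ⟨-, hu, hv⟩ := hK K hKF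
      obtain ⟨-, hu', hv'⟩ := hK K' hKF'
      have h : (K.erase u).erase v = (K'.erase u).erase v := h
      rw [← insert_erase hu, ← insert_erase (mem_erase.2 ⟨huv.ne', hv⟩), h,
        insert_erase (mem_erase.2 ⟨huv.ne', hv'⟩), insert_erase hu']
  rw [card_powersetCard, card_univ] at hcard
  exact hcard.trans (Nat.choose_le_pow _ _)

/-- A graph with an `s`-clique, `s ≥ 2`, has a nonempty `s`-joint. -/
theorem IsNClique.one_le_jointSize {V : Type*} [Fintype V] {G : SimpleGraph V} {s : ℕ}
    (hs : 2 ≤ s) {K : Finset V} (hK : G.IsNClique s K) : 1 ≤ G.jointSize s := by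
  obtain ⟨u, hu, v, hv, huv⟩ := one_lt_card.1 (by rw [hK.card_eq]; omega)
  have : G.IsJoint s {K} := ⟨u, v, hK.isClique hu hv huv, by simpa using ⟨hK, hu, hv⟩⟩
  simpa using this.card_le_jointSize

/-! ### Tightness: nearly complete graphs -/

/-- The spectral radius is at least the average degree. -/
theorem average_degree_le_largestEigenvalue {V : Type*} [Fintype V] (G : SimpleGraph V) :
    2 * (G.edgeSet.ncard : ℝ) ≤ G.largestEigenvalue * Fintype.card V := by
  classical
  have h := G.adjForm_le fun _ => 1
  simpa [adjForm, ← sum_sum_adj_one] using h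

theorem exists_graph_ncard_edgeSet {n m : ℕ} (h : m ≤ n.choose 2) :
    ∃ G : SimpleGraph (Fin n), G.edgeSet.ncard = m := by
  classical
  have hc : ((⊤ : SimpleGraph (Fin n)).edgeFinset).card = n.choose 2 := by
    rw [card_edgeFinset_top_eq_card_choose_two, Fintype.card_fin]
  obtain ⟨S, hS, hSm⟩ := exists_subset_card_eq (h.trans hc.ge)
  refine ⟨fromEdgeSet S, ?_⟩
  rw [edgeSet_fromEdgeSet, sdiff_eq_left.2, Set.ncard_coe_finset, hSm]
  rw [Set.disjoint_left]
  intro e he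
  have := hS he
  rw [mem_edgeFinset] at this
  exact not_isDiag_of_mem_edgeSet _ this

/-- For every large `m`, some graph with `m` edges on `O(√m)` vertices exceeds the spectral
threshold: delete few edges from a complete graph. -/
theorem exists_tight_graph {r : ℕ} (hr : 1 ≤ r) {m : ℕ} (hm : (9 * r) ^ 2 ≤ m) :
    ∃ (n : ℕ) (G : SimpleGraph (Fin n)), G.edgeSet.ncard = m ∧
      (1 - 1 / (r : ℝ)) * (2 * (m : ℝ)) < G.largestEigenvalue ^ 2 ∧ (n : ℝ) ^ 2 ≤ 9 * m := by
  have hex : ∃ n : ℕ, m ≤ n.choose 2 := by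
    refine ⟨2 * m + 1, ?_⟩
    rw [Nat.choose_two_right]
    rw [Nat.le_div_iff_mul_le two_pos]
    simp only [add_tsub_cancel_right]
    nlinarith
  classical
  set n := Nat.find hex with hn
  have h1 : m ≤ n.choose 2 := Nat.find_spec hex
  have hr1 : (1 : ℝ) ≤ r := by exact_mod_cast hr
  have hmR : (9 * (r : ℝ)) ^ 2 ≤ m := by exact_mod_cast hm
  have h1' : (m : ℝ) ≤ n * (n - 1) / 2 := by
    rw [← Nat.cast_choose_two]; exact_mod_cast h1
  have hnr : 9 * (r : ℝ) ≤ n := by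
    by_contra! hlt
    have hn0 : (0 : ℝ) ≤ n := Nat.cast_nonneg _
    nlinarith
  have h2 : (n - 1 : ℝ) * (n - 2) / 2 < m := by
    have hpos : 1 ≤ n := by
      have : (1 : ℝ) ≤ n := by linarith
      exact_mod_cast this
    have h3 := Nat.find_min hex (m := n - 1) (by omega)
    rw [not_le] at h3
    have h4 : (((n - 1).choose 2 : ℕ) : ℝ) < m := by exact_mod_cast h3
    rw [Nat.cast_choose_two, Nat.cast_sub hpos] at h4
    push_cast at h4
    linarith
  obtain ⟨G, hG⟩ := exists_graph_ncard_edgeSet h1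
  refine ⟨n, G, hG, ?_, by nlinarith⟩
  have h5 := G.average_degree_le_largestEigenvalue
  rw [hG, Fintype.card_fin] at h5
  have hn0 : (0 : ℝ) < n := by linarith
  have hm0 : (0 : ℝ) < m := lt_of_lt_of_le (by positivity) hmR
  have h6 : (2 * (m : ℝ)) ^ 2 ≤ G.largestEigenvalue ^ 2 * n ^ 2 := by
    rw [← mul_pow]; exact pow_le_pow_left₀ (by positivity) h5 2
  have h7 : (1 - 1 / (r : ℝ)) * n ^ 2 < 2 * m := by
    have h8 : (n : ℝ) ^ 2 / r ≥ 9 * n := by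
      rw [ge_iff_le, le_div_iff₀ (by linarith)]; nlinarith
    have h9 : (1 - 1 / (r : ℝ)) * n ^ 2 = n ^ 2 - n ^ 2 / r := by ring
    rw [h9]; nlinarith
  have h10 : (1 - 1 / (r : ℝ)) * (2 * (m : ℝ)) * n ^ 2 < G.largestEigenvalue ^ 2 * n ^ 2 := by
    refine lt_of_lt_of_le ?_ h6
    nlinarith
  exact lt_of_mul_lt_mul_right h10 (by positivity)

end SimpleGraph

namespace SimpleGraph

open Finset Matrix

/-! ### Edge-critical subgraphs -/

/-- `H` is `α`-edge-critical if no subgraph `H'` has a larger ratio `λ(H')² / e(H')^α`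
(written without division, so that edgeless subgraphs are covered). -/
def IsEdgeCritical {V : Type*} [Fintype V] (H : SimpleGraph V) (α : ℝ) : Prop :=
  ∀ H' ≤ H, H'.largestEigenvalue ^ 2 * (H.edgeSet.ncard : ℝ) ^ α ≤
    H.largestEigenvalue ^ 2 * (H'.edgeSet.ncard : ℝ) ^ α

variable {V : Type*} [Fintype V]

theorem largestEigenvalue_eq_zero_of_ncard_eq_zero {G : SimpleGraph V}
    (h : G.edgeSet.ncard = 0) : G.largestEigenvalue = 0 := by
  have := G.largestEigenvalue_sq_le
  rw [h] at this
  have h2 := sq_nonneg G.largestEigenvalue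
  exact pow_eq_zero_iff two_ne_zero |>.1 (by push_cast at this; linarith)

theorem ncard_edgeSet_mono {G H : SimpleGraph V} (h : H ≤ G) :
    H.edgeSet.ncard ≤ G.edgeSet.ncard :=
  Set.ncard_le_ncard (edgeSet_mono h) (Set.toFinite _)

/-- A graph above the threshold contains an edge-critical subgraph above the threshold. Since
`λ² ≤ 2m` always holds and `α < 1`, this subgraph keeps a positive fraction of the edges. -/
theorem exists_isEdgeCritical (G : SimpleGraph V) {ρ α : ℝ} (hρ : 0 < ρ)
    (hα1 : α < 1) (hG : ρ * (2 * G.edgeSet.ncard) < G.largestEigenvalue ^ 2) :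
    ∃ H ≤ G, H.IsEdgeCritical α ∧ 0 < H.edgeSet.ncard ∧
      ρ * (2 * H.edgeSet.ncard) < H.largestEigenvalue ^ 2 ∧
      ρ ^ (1 / (1 - α)) * G.edgeSet.ncard ≤ (H.edgeSet.ncard : ℝ) := by
  classical
  have hlG : 0 < G.largestEigenvalue ^ 2 := lt_of_le_of_lt (by positivity) hG
  have hmG : 0 < G.edgeSet.ncard := by
    by_contra! h
    rw [largestEigenvalue_eq_zero_of_ncard_eq_zero (by omega)] at hlG
    simp at hlG
  have hmG' : (0 : ℝ) < G.edgeSet.ncard := by exact_mod_cast hmG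
  have : Nonempty {H : SimpleGraph V // H ≤ G} := ⟨⟨G, le_rfl⟩⟩
  obtain ⟨⟨H, hHG⟩, hmax⟩ := Finite.exists_max (fun H : {H : SimpleGraph V // H ≤ G} =>
    H.1.largestEigenvalue ^ 2 / (H.1.edgeSet.ncard : ℝ) ^ α)
  have hGH := hmax ⟨G, le_rfl⟩
  simp only at hGH
  have hmH : 0 < H.edgeSet.ncard := by
    by_contra! h
    rw [largestEigenvalue_eq_zero_of_ncard_eq_zero (G := H) (by omega)] at hGH
    have : 0 < G.largestEigenvalue ^ 2 / (G.edgeSet.ncard : ℝ) ^ α := by positivity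
    simp at hGH
    linarith
  have hmH' : (0 : ℝ) < H.edgeSet.ncard := by exact_mod_cast hmH
  have hle : (H.edgeSet.ncard : ℝ) ≤ G.edgeSet.ncard := by exact_mod_cast ncard_edgeSet_mono hHG
  rw [div_le_div_iff₀ (by positivity) (by positivity)] at hGH
  set a : ℝ := ((H.edgeSet.ncard : ℕ) : ℝ)
  set b : ℝ := ((G.edgeSet.ncard : ℕ) : ℝ)
  have hbα : b ^ α * b ^ (1 - α) = b := by rw [← Real.rpow_add hmG']; simp
  have haα : a ^ α * a ^ (1 - α) = a := by rw [← Real.rpow_add hmH']; simp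
  have hab : a ^ (1 - α) ≤ b ^ (1 - α) := Real.rpow_le_rpow hmH'.le hle (by linarith)
  have haα0 : 0 < a ^ α := by positivity
  have hbα0 : 0 < b ^ α := by positivity
  -- the common lower bound `λ(H)² > 2ρ b^(1-α) a^α`
  have hkey : ρ * 2 * b ^ (1 - α) * a ^ α < H.largestEigenvalue ^ 2 := by
    have : ρ * 2 * b ^ (1 - α) * a ^ α * b ^ α < H.largestEigenvalue ^ 2 * b ^ α := by
      calc ρ * 2 * b ^ (1 - α) * a ^ α * b ^ α = ρ * (2 * (b ^ α * b ^ (1 - α))) * a ^ α := by ring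
        _ = ρ * (2 * b) * a ^ α := by rw [hbα]
        _ < G.largestEigenvalue ^ 2 * a ^ α := by gcongr
        _ ≤ _ := hGH
    exact lt_of_mul_lt_mul_right this hbα0.le
  refine ⟨H, hHG, ?_, hmH, ?_, ?_⟩
  · intro H' hH'
    rcases Nat.eq_zero_or_pos H'.edgeSet.ncard with h0 | hpos
    · rw [largestEigenvalue_eq_zero_of_ncard_eq_zero h0]
      simp only [ne_eq, OfNat.ofNat_ne_zero, not_false_eq_true, zero_pow, zero_mul]
      positivity
    · have hpos' : (0 : ℝ) < H'.edgeSet.ncard := by exact_mod_cast hpos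
      have h := hmax ⟨H', hH'.trans hHG⟩
      simp only at h
      rwa [div_le_div_iff₀ (by positivity) (by positivity)] at h
  · refine lt_of_le_of_lt ?_ hkey
    calc ρ * (2 * a) = ρ * 2 * (a ^ α * a ^ (1 - α)) := by rw [haα]; ring
      _ ≤ ρ * 2 * (a ^ α * b ^ (1 - α)) := by gcongr
      _ = _ := by ring
  · have h1 : ρ * b ^ (1 - α) ≤ a ^ (1 - α) := by
      have h2 := H.largestEigenvalue_sq_le
      have h3 : ρ * b ^ (1 - α) * (2 * a ^ α) ≤ a ^ (1 - α) * (2 * a ^ α) := by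
        calc ρ * b ^ (1 - α) * (2 * a ^ α) = ρ * 2 * b ^ (1 - α) * a ^ α := by ring
          _ ≤ 2 * a := hkey.le.trans h2
          _ = 2 * (a ^ α * a ^ (1 - α)) := by rw [haα]
          _ = a ^ (1 - α) * (2 * a ^ α) := by ring
      exact le_of_mul_le_mul_right h3 (by positivity)
    have h4 : 0 < 1 - α := by linarith
    have h5 := Real.rpow_le_rpow (by positivity) h1 (z := 1 / (1 - α)) (by positivity)
    rwa [Real.mul_rpow hρ.le (by positivity), ← Real.rpow_mul hmG'.le, ← Real.rpow_mul hmH'.le,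
      mul_one_div_cancel h4.ne', Real.rpow_one, Real.rpow_one] at h5

/-- Deleting `k` of the `m` edges of an edge-critical graph multiplies `λ²` by at most
`1 - α k / m`. -/
theorem IsEdgeCritical.sq_le {H H' : SimpleGraph V} {α : ℝ} (hH : H.IsEdgeCritical α)
    (hα0 : 0 ≤ α) (hα1 : α ≤ 1) (hm : 0 < H.edgeSet.ncard) (hle : H' ≤ H) {k : ℕ}
    (hk : H.edgeSet.ncard = H'.edgeSet.ncard + k) :
    H'.largestEigenvalue ^ 2 ≤ H.largestEigenvalue ^ 2 * (1 - α * (k / H.edgeSet.ncard)) := by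
  have hm' : (0 : ℝ) < H.edgeSet.ncard := by exact_mod_cast hm
  have h := hH H' hle
  have hk' : (H'.edgeSet.ncard : ℝ) = H.edgeSet.ncard * (1 + -(k / H.edgeSet.ncard)) := by
    rw [mul_add, mul_neg, mul_div_cancel₀ _ hm'.ne', hk]; push_cast; ring
  have h0 : (-1 : ℝ) ≤ -(k / H.edgeSet.ncard) := by
    rw [neg_le_neg_iff, div_le_one hm']
    exact_mod_cast (by omega)
  rw [hk', Real.mul_rpow hm'.le (by linarith)] at h
  have h1 := rpow_one_add_le_one_add_mul_self h0 hα0 hα1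
  have h2 : H'.largestEigenvalue ^ 2 ≤
      H.largestEigenvalue ^ 2 * (1 + -(k / H.edgeSet.ncard : ℝ)) ^ α := by
    refine le_of_mul_le_mul_right (h.trans_eq ?_) (show (0 : ℝ) < (H.edgeSet.ncard : ℝ) ^ α by
      positivity)
    ring
  refine h2.trans (mul_le_mul_of_nonneg_left (h1.trans_eq (by ring)) (sq_nonneg _))

end SimpleGraph

namespace SimpleGraph

open Finset Matrix

/-! ### The Perron vector of an edge-critical graph -/

variable {V : Type*} [Fintype V] {H : SimpleGraph V} {x : V → ℝ} {α : ℝ}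

theorem adjForm_eq_deleteEdges_add (z : V → ℝ) {u w : V} (h : H.Adj u w) :
    H.adjForm z = (H.deleteEdges {s(u, w)}).adjForm z + 2 * (z u * z w) := by
  classical
  have hne := h.ne
  have h1 : ∑ a, ∑ b, (if a = u then if b = w then z u * z w else 0 else 0) = z u * z w := by
    simp
  have h2 : ∑ a, ∑ b, (if a = w then if b = u then z u * z w else 0 else 0) = z u * z w := by
    simp
  have h3 : 2 * (z u * z w) = ∑ a, ∑ b, ((if a = u then if b = w then z u * z w else 0 else 0) +
      (if a = w then if b = u then z u * z w else 0 else 0)) := by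
    simp_rw [sum_add_distrib]; rw [h1, h2]; ring
  rw [h3, adjForm, adjForm, ← sum_add_distrib]
  refine sum_congr rfl fun a _ => ?_
  rw [← sum_add_distrib]
  refine sum_congr rfl fun b _ => ?_
  by_cases h4 : a = u ∧ b = w
  · obtain ⟨rfl, rfl⟩ := h4
    simp [h, hne]
  by_cases h5 : a = w ∧ b = u
  · obtain ⟨rfl, rfl⟩ := h5
    simp [h.symm, hne.symm, Sym2.eq_swap]; ring
  have h6 : (H.deleteEdges {s(u, w)}).Adj a b ↔ H.Adj a b := by
    simp [h4, h5]
  simp only [h6]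
  have h7 : (if a = u then if b = w then z u * z w else 0 else 0) = 0 := by
    rw [← ite_and, if_neg h4]
  have h8 : (if a = w then if b = u then z u * z w else 0 else 0) = 0 := by
    rw [← ite_and, if_neg h5]
  rw [h7, h8]; ring

/-- Every edge of an edge-critical graph carries at least (about) half of the mean of `x u * x w`
over all edges: otherwise deleting it would increase `λ² / m^α`. -/
theorem IsEdgeCritical.le_mul_of_adj (hH : H.IsEdgeCritical α) (hα0 : 0 ≤ α) (hα1 : α ≤ 1)
    (hx : H.IsPerronVector x) (hl : 0 < H.largestEigenvalue) {u w : V} (h : H.Adj u w) :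
    α * H.largestEigenvalue ≤ 4 * H.edgeSet.ncard * (x u * x w) := by
  classical
  have hcard : H.edgeSet.ncard = (H.deleteEdges {s(u, w)}).edgeSet.ncard + 1 := by
    rw [edgeSet_deleteEdges]
    exact (Set.ncard_sdiff_singleton_add_one (H.mem_edgeSet.2 h) (Set.toFinite _)).symm
  have hm : 0 < H.edgeSet.ncard := by omega
  have hm' : (0 : ℝ) < H.edgeSet.ncard := by exact_mod_cast hm
  have h1 := hH.sq_le hα0 hα1 hm (H.deleteEdges_le _) hcard
  have h2 := (H.deleteEdges {s(u, w)}).adjForm_le x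
  have h3 := H.adjForm_eq_deleteEdges_add x h
  rw [hx.adjForm_eq] at h3
  rw [hx.sum_sq, mul_one] at h2
  have h4 : 0 ≤ (H.deleteEdges {s(u, w)}).adjForm x := adjForm_nonneg hx.nonneg
  set l := H.largestEigenvalue
  set p := x u * x w
  have h5 : (l - 2 * p) ^ 2 ≤ (H.deleteEdges {s(u, w)}).largestEigenvalue ^ 2 :=
    pow_le_pow_left₀ (by linarith) (by linarith) 2
  have h6 := h5.trans h1
  have h7 : α * l * l ≤ 4 * H.edgeSet.ncard * p * l := by
    have h8 : l ^ 2 * (α * ((1 : ℕ) / H.edgeSet.ncard)) ≤ 4 * p * l := by nlinarith [sq_nonneg p]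
    have h9 := mul_le_mul_of_nonneg_left h8 hm'.le
    have h10 : (H.edgeSet.ncard : ℝ) * (l ^ 2 * (α * ((1 : ℕ) / H.edgeSet.ncard))) = α * l * l := by
      push_cast; field_simp
    rw [h10] at h9
    linarith
  exact le_of_mul_le_mul_right h7 hl

open Classical in
theorem IsPerronVector.adjForm_deleteIncidenceSet (hx : H.IsPerronVector x) (v : V) :
    (H.deleteIncidenceSet v).adjForm (Function.update x v 0) =
      H.largestEigenvalue * (1 - 2 * x v ^ 2) := by
  have h1 : ∑ a, ∑ b, (if a = v then if H.Adj a b then x a * x b else 0 else 0) =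
      H.largestEigenvalue * x v ^ 2 := by
    have : ∀ a, ∑ b, (if a = v then if H.Adj a b then x a * x b else 0 else 0) =
        if a = v then x a * ∑ b, (if H.Adj a b then x b else 0) else 0 := by
      intro a
      split_ifs
      · rw [mul_sum]; exact sum_congr rfl fun b _ => by split_ifs <;> simp
      · simp
    simp_rw [this, hx.sum_adj, sum_ite_eq' univ v, mem_univ, if_true]
    ring
  have h2 : ∑ a, ∑ b, (if b = v then if H.Adj a b then x a * x b else 0 else 0) =
      H.largestEigenvalue * x v ^ 2 := by
    rw [sum_comm, ← h1]
    refine sum_congr rfl fun a _ => sum_congr rfl fun b _ => ?_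
    simp only [H.adj_comm b a, mul_comm (x b)]
  have h3 := hx.adjForm_eq
  have h4 : (H.deleteIncidenceSet v).adjForm (Function.update x v 0) = H.adjForm x -
      ∑ a, ∑ b, (if a = v then if H.Adj a b then x a * x b else 0 else 0) -
      ∑ a, ∑ b, (if b = v then if H.Adj a b then x a * x b else 0 else 0) := by
    rw [adjForm, adjForm, ← sum_sub_distrib, ← sum_sub_distrib]
    refine sum_congr rfl fun a _ => ?_
    rw [← sum_sub_distrib, ← sum_sub_distrib]
    refine sum_congr rfl fun b _ => ?_
    rw [deleteIncidenceSet_adj]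
    by_cases ha : a = v <;> by_cases hb : b = v
    · subst ha; subst hb; simp
    · simp [ha, hb]
    · simp [ha, hb]
    · simp [ha, hb]
  rw [h4, h1, h2, h3]; ring

/-- Deleting a vertex does not increase `λ² / m^α`; the trial vector for the remaining graph is
the restriction of the Perron vector. -/
theorem IsEdgeCritical.degree_le (hH : H.IsEdgeCritical α) (hα0 : 0 ≤ α) (hα1 : α ≤ 1)
    (hx : H.IsPerronVector x) (hl : 0 < H.largestEigenvalue) (hm : 0 < H.edgeSet.ncard) (v : V) :
    open Classical in
    α * H.degree v * (1 - x v ^ 2) ^ 2 ≤ H.edgeSet.ncard * (x v ^ 2 * (2 - 3 * x v ^ 2)) := by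
  classical
  have hcard : H.edgeSet.ncard = (H.deleteIncidenceSet v).edgeSet.ncard + H.degree v := by
    have h := H.card_edgeFinset_deleteIncidenceSet v
    have h' := H.degree_le_card_edgeFinset v
    rw [← coe_edgeFinset, ← coe_edgeFinset, Set.ncard_coe_finset, Set.ncard_coe_finset]
    convert (Nat.sub_eq_iff_eq_add h').1 h.symm using 2
  have hm' : (0 : ℝ) < H.edgeSet.ncard := by exact_mod_cast hm
  have h1 := hH.sq_le hα0 hα1 hm (H.deleteIncidenceSet_le v) hcard
  have h2 := (H.deleteIncidenceSet v).adjForm_le (Function.update x v 0)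
  have h3 := hx.adjForm_deleteIncidenceSet v
  have h4 : 0 ≤ (H.deleteIncidenceSet v).adjForm (Function.update x v 0) := by
    refine adjForm_nonneg fun w => ?_
    by_cases hw : w = v
    · subst hw; simp
    · simp [hw, hx.nonneg w]
  have h5 : ∑ w, Function.update x v 0 w ^ 2 = 1 - x v ^ 2 := by
    rw [← hx.sum_sq, ← sum_erase_add _ _ (mem_univ v), ← sum_erase_add univ _ (mem_univ v)]
    simp only [Function.update_self, ne_eq, OfNat.ofNat_ne_zero, not_false_eq_true, zero_pow,
      add_zero, add_sub_cancel_right]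
    refine sum_congr rfl fun w hw => ?_
    rw [Function.update_of_ne (ne_of_mem_erase hw)]
  rw [h5] at h2
  rw [h3] at h2 h4
  set l := H.largestEigenvalue
  set l' := (H.deleteIncidenceSet v).largestEigenvalue
  set y := x v ^ 2
  set m : ℝ := ((H.edgeSet.ncard : ℕ) : ℝ)
  set d : ℝ := (H.degree v : ℝ)
  have h6 : (l * (1 - 2 * y)) ^ 2 ≤ l ^ 2 * (1 - α * (d / m)) * (1 - y) ^ 2 :=
    calc (l * (1 - 2 * y)) ^ 2 ≤ (l' * (1 - y)) ^ 2 := pow_le_pow_left₀ h4 h2 2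
      _ = l' ^ 2 * (1 - y) ^ 2 := by ring
      _ ≤ _ := mul_le_mul_of_nonneg_right h1 (sq_nonneg _)
  have h7 : (1 - 2 * y) ^ 2 ≤ (1 - α * (d / m)) * (1 - y) ^ 2 := by
    have : l ^ 2 * (1 - 2 * y) ^ 2 ≤ l ^ 2 * ((1 - α * (d / m)) * (1 - y) ^ 2) := by linarith
    exact le_of_mul_le_mul_left this (by positivity)
  have h8 : α * (d / m) * (1 - y) ^ 2 ≤ y * (2 - 3 * y) := by linarith
  calc α * d * (1 - y) ^ 2 = m * (α * (d / m) * (1 - y) ^ 2) := by field_simp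
    _ ≤ _ := by gcongr

theorem IsPerronVector.sq_le_half (hx : H.IsPerronVector x) (hl : 0 < H.largestEigenvalue)
    (v : V) : x v ^ 2 ≤ 1 / 2 := by
  classical
  have h4 : 0 ≤ (H.deleteIncidenceSet v).adjForm (Function.update x v 0) := by
    refine adjForm_nonneg fun w => ?_
    by_cases hw : w = v
    · subst hw; simp
    · simp [hw, hx.nonneg w]
  rw [hx.adjForm_deleteIncidenceSet v] at h4
  have := nonneg_of_mul_nonneg_right h4 hl
  linarith

/-! ### Light neighbours -/

open Classical in
/-- The neighbours `w` of `v` for which the edge `vw` is light: `x v * x w ≤ T`. -/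
noncomputable def lightNeighbors (H : SimpleGraph V) (x : V → ℝ) (T : ℝ) (v : V) : Finset V :=
  univ.filter fun w => H.Adj v w ∧ x v * x w ≤ T

theorem mem_lightNeighbors {T : ℝ} {v w : V} :
    w ∈ H.lightNeighbors x T v ↔ H.Adj v w ∧ x v * x w ≤ T := by
  simp [lightNeighbors]

/-- Heavy edges contribute little to the eigenvalue equation at `v`, hence the light neighbours
carry most of it. -/
theorem IsPerronVector.le_sum_lightNeighbors (hx : H.IsPerronVector x) {T : ℝ} (v : V) :
    T * (H.largestEigenvalue * x v) - x v ≤ T * ∑ w ∈ H.lightNeighbors x T v, x w := by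
  classical
  have h0 : ∑ w ∈ H.lightNeighbors x T v, x w =
      ∑ w, (if w ∈ H.lightNeighbors x T v then x w else 0) := by
    rw [← sum_filter]; simp
  have h1 : x v = ∑ w, x v * x w ^ 2 := by rw [← mul_sum, hx.sum_sq, mul_one]
  rw [← hx.sum_adj v, h0, mul_sum, mul_sum, sub_le_iff_le_add]
  rw [h1]
  rw [← sum_add_distrib]
  refine sum_le_sum fun w _ => ?_
  simp only [mem_lightNeighbors]
  have hv := hx.nonneg v
  have hw := hx.nonneg w
  have hp : 0 ≤ x v * x w ^ 2 := by positivity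
  by_cases h2 : H.Adj v w <;> by_cases h3 : x v * x w ≤ T
  · simp only [h2, h3, and_self, if_true]; linarith
  · simp only [h2, h3, and_false, if_true, if_false]
    push Not at h3
    nlinarith
  · simp only [h2, false_and, if_false]; linarith
  · simp only [h2, false_and, if_false]; linarith

/-- The `x²`-weight of the light neighbourhood of `v` in an edge-critical graph. -/
theorem IsEdgeCritical.le_sum_sq_lightNeighbors (hH : H.IsEdgeCritical α) (hα0 : 0 ≤ α)
    (hα1 : α ≤ 1) (hx : H.IsPerronVector x) (hm : 0 < H.edgeSet.ncard) {ρ : ℝ} (hρ : 1 / 2 ≤ ρ)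
    (hl : 0 < H.largestEigenvalue)
    (hlm : ρ * (2 * H.edgeSet.ncard) ≤ H.largestEigenvalue ^ 2) {L : ℝ} (hL : 1 ≤ L) {v : V}
    (hv : 0 < x v) :
    α * (1 - 1 / L) ^ 2 * ρ * (2 * (1 - x v ^ 2) ^ 2) ≤
      (∑ w ∈ H.lightNeighbors x (L / √H.edgeSet.ncard) v, x w ^ 2) * (2 - 3 * x v ^ 2) := by
  classical
  have hm' : (0 : ℝ) < H.edgeSet.ncard := by exact_mod_cast hm
  have hdeg := hH.degree_le hα0 hα1 hx hl hm v
  set l := H.largestEigenvalue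
  set m : ℝ := ((H.edgeSet.ncard : ℕ) : ℝ)
  set d : ℝ := (H.degree v : ℝ)
  set y := x v ^ 2 with hy
  set N := H.lightNeighbors x (L / √m) v with hN
  set D := ∑ w ∈ N, x w ^ 2
  have hD : 0 ≤ D := sum_nonneg fun w _ => sq_nonneg _
  have hml : √m ≤ l := by
    rw [Real.sqrt_le_left hl.le]; nlinarith
  have hsm : 0 < √m := Real.sqrt_pos.2 hm'
  have hL0 : 0 < L := by linarith
  have h1 : (1 - 1 / L) * (l * x v) ≤ ∑ w ∈ N, x w := by
    have h := hx.le_sum_lightNeighbors (T := L / √m) v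
    have hT : 0 < L / √m := by positivity
    have h2 : L / √m * ((1 - 1 / L) * (l * x v)) ≤ L / √m * (l * x v) - x v := by
      have h3 : L / √m * ((1 - 1 / L) * (l * x v)) = L / √m * (l * x v) - l / √m * x v := by
        field_simp
      have h4 : 1 ≤ l / √m := (one_le_div hsm).2 hml
      rw [h3]; nlinarith
    exact le_of_mul_le_mul_left (h2.trans h) hT
  have h2 : (∑ w ∈ N, x w) ^ 2 ≤ d * D := by
    refine (sq_sum_le_card_mul_sum_sq).trans ?_
    refine mul_le_mul_of_nonneg_right ?_ hD
    have : N.card ≤ (H.neighborFinset v).card := by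
      refine card_le_card fun w hw => ?_
      rw [mem_neighborFinset]
      exact (mem_lightNeighbors.1 hw).1
    rw [card_neighborFinset_eq_degree] at this
    exact (Nat.cast_le (α := ℝ)).2 this
  have hL1 : 0 ≤ 1 - 1 / L := by
    rw [sub_nonneg, div_le_one hL0]; exact hL
  have h3 : ((1 - 1 / L) * (l * x v)) ^ 2 ≤ d * D :=
    (pow_le_pow_left₀ (by positivity) h1 2).trans h2
  have hy0 : 0 < y := by positivity
  have h4 : α * (1 - 1 / L) ^ 2 * ρ * (2 * (1 - y) ^ 2) * (m * y) ≤
      D * (2 - 3 * y) * (m * y) := by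
    calc α * (1 - 1 / L) ^ 2 * ρ * (2 * (1 - y) ^ 2) * (m * y) =
        α * (1 - y) ^ 2 * ((1 - 1 / L) ^ 2 * y * (ρ * (2 * m))) := by ring
      _ ≤ α * (1 - y) ^ 2 * ((1 - 1 / L) ^ 2 * y * l ^ 2) := by gcongr
      _ = α * (1 - y) ^ 2 * ((1 - 1 / L) * (l * x v)) ^ 2 := by rw [hy]; ring
      _ ≤ α * (1 - y) ^ 2 * (d * D) := by gcongr
      _ = α * d * (1 - y) ^ 2 * D := by ring
      _ ≤ m * (y * (2 - 3 * y)) * D := by gcongr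
      _ = _ := by ring
  exact le_of_mul_le_mul_right h4 (by positivity)

end SimpleGraph

namespace SimpleGraph

open Finset Matrix

/-! ### Cliques in weighted graphs -/

variable {V : Type*} [Fintype V] {G : SimpleGraph V}

open Classical in
/-- The members of `S` adjacent to all of `K`. -/
noncomputable def commonNeighborsIn (G : SimpleGraph V) (S K : Finset V) : Finset V :=
  S.filter fun w => ∀ v ∈ K, G.Adj v w

theorem mem_commonNeighborsIn {S K : Finset V} {w : V} :
    w ∈ G.commonNeighborsIn S K ↔ w ∈ S ∧ ∀ v ∈ K, G.Adj v w := by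
  simp [commonNeighborsIn]

/-- Union bound: each `v ∈ K` excludes at most the weight `δ` of its non-neighbours. -/
theorem le_sum_commonNeighborsIn {y : V → ℝ} (hy : ∀ v, 0 ≤ y v) (hy1 : ∑ v, y v = 1) {δ : ℝ}
    (S K : Finset V)
    (hK : open Classical in ∀ v ∈ K, 1 - δ ≤ ∑ w, if G.Adj v w then y w else 0) :
    ∑ w ∈ S, y w - K.card * δ ≤ ∑ w ∈ G.commonNeighborsIn S K, y w := by
  classical
  have h1 : ∑ v ∈ K, ∑ w, (if G.Adj v w then 0 else y w) ≤ K.card * δ := by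
    rw [← nsmul_eq_mul]
    refine sum_le_card_nsmul _ _ _ fun v hv => ?_
    have h2 : ∑ w, (if G.Adj v w then 0 else y w) + ∑ w, (if G.Adj v w then y w else 0) = 1 := by
      rw [← sum_add_distrib, ← hy1]
      exact sum_congr rfl fun w _ => by split_ifs <;> simp
    linarith [hK v hv]
  have h3 : ∑ w ∈ S, y w ≤ ∑ w ∈ G.commonNeighborsIn S K, y w +
      ∑ v ∈ K, ∑ w, (if G.Adj v w then 0 else y w) := by
    rw [sum_comm, commonNeighborsIn, sum_filter]
    have h4 : ∀ w, 0 ≤ ∑ v ∈ K, (if G.Adj v w then 0 else y w) := fun w =>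
      sum_nonneg fun v _ => by split_ifs <;> simp [hy w]
    calc ∑ w ∈ S, y w ≤ ∑ w ∈ S, ((if ∀ v ∈ K, G.Adj v w then y w else 0) +
          ∑ v ∈ K, (if G.Adj v w then 0 else y w)) := by
          refine sum_le_sum fun w _ => ?_
          split_ifs with h
          · linarith [h4 w]
          · push Not at h
            obtain ⟨v, hv, hvw⟩ := h
            have := single_le_sum (f := fun v => if G.Adj v w then 0 else y w)
              (fun v _ => by split_ifs <;> simp [hy w]) hv
            simp only [hvw, if_false] at this
            linarith
      _ ≤ _ := by
          rw [sum_add_distrib]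
          exact add_le_add le_rfl
            (sum_le_sum_of_subset_of_nonneg (subset_univ _) fun w _ _ => h4 w)
  linarith

/-- At a maximizer of the form on the simplex, the neighbourhood of every vertex of positive
weight weighs at least the maximum: otherwise shifting weight away from that vertex would increase
the form. -/
theorem le_sum_adj_of_isMaxOn {y : V → ℝ} (hy : y ∈ stdSimplex ℝ V)
    (hmax : IsMaxOn G.adjForm (stdSimplex ℝ V) y) {v : V} (hv : 0 < y v) :
    open Classical in
    G.adjForm y ≤ ∑ w, if G.Adj v w then y w else 0 := by
  classical
  set D := ∑ w, if G.Adj v w then y w else 0 with hD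
  -- the form along the perturbation `(1 + t) y - t eᵥ`, which stays in the simplex for `t ≤ y v`
  have hform : ∀ t : ℝ, G.adjForm (fun w => (1 + t) * y w - if w = v then t else 0) =
      (1 + t) ^ 2 * G.adjForm y - 2 * t * (1 + t) * D := by
    intro t
    have h1 : ∑ a, ∑ b, (if a = v then if G.Adj a b then y b else 0 else 0) = D := by
      have : ∀ a, ∑ b, (if a = v then if G.Adj a b then y b else 0 else 0) =
          if a = v then ∑ b, (if G.Adj a b then y b else 0) else 0 := by
        intro a; split_ifs <;> simp
      simp_rw [this, sum_ite_eq' univ v, mem_univ, if_true]; rfl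
    have h2 : ∑ a, ∑ b, (if b = v then if G.Adj a b then y a else 0 else 0) = D := by
      rw [sum_comm, ← h1]
      refine sum_congr rfl fun a _ => sum_congr rfl fun b _ => ?_
      simp only [G.adj_comm b a]
    have h3 : (1 + t) ^ 2 * G.adjForm y - 2 * t * (1 + t) * D = (1 + t) ^ 2 * G.adjForm y -
        t * (1 + t) * ∑ a, ∑ b, (if a = v then if G.Adj a b then y b else 0 else 0) -
        t * (1 + t) * ∑ a, ∑ b, (if b = v then if G.Adj a b then y a else 0 else 0) := by
      rw [h1, h2]; ring
    rw [h3, adjForm, adjForm, mul_sum, mul_sum, mul_sum, ← sum_sub_distrib, ← sum_sub_distrib]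
    refine sum_congr rfl fun a _ => ?_
    rw [mul_sum, mul_sum, mul_sum, ← sum_sub_distrib, ← sum_sub_distrib]
    refine sum_congr rfl fun b _ => ?_
    by_cases hab : G.Adj a b
    · by_cases ha : a = v <;> by_cases hb : b = v
      · subst ha; subst hb; exact (hab.ne rfl).elim
      all_goals
        simp only [if_pos hab]
        simp only [ha, hb, if_true, if_false]
        ring
    · simp [hab]
  have hvle : y v ≤ 1 := by
    rw [← hy.2]; exact single_le_sum (f := y) (fun w _ => hy.1 w) (mem_univ v)
  have hle : ∀ t : ℝ, 0 < t → t ≤ y v → (2 + t) * G.adjForm y ≤ 2 * (1 + t) * D := by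
    intro t ht0 ht1
    have hmem : (fun w => (1 + t) * y w - if w = v then t else 0) ∈ stdSimplex ℝ V := by
      refine ⟨fun w => ?_, ?_⟩
      · have := hy.1 w
        show (0 : ℝ) ≤ (1 + t) * y w - if w = v then t else 0
        split_ifs with h
        · subst h; nlinarith
        · nlinarith
      · rw [sum_sub_distrib, ← mul_sum, hy.2]; simp
    have h := hmax hmem
    simp only [Set.mem_ofPred_eq] at h
    rw [hform] at h
    have : t * ((2 + t) * G.adjForm y) ≤ t * (2 * (1 + t) * D) := by linarith
    exact le_of_mul_le_mul_left this ht0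
  by_contra! hlt
  have hA : 0 ≤ D := sum_nonneg fun w _ => by split_ifs <;> simp [hy.1 w]
  set A := G.adjForm y
  -- `(2 + t) A ≤ 2 (1 + t) D` fails for small `t > 0` if `D < A`
  have hgap : 0 < A - D := by linarith
  have hA0 : 0 < A := by linarith
  obtain ⟨t, ht0, ht1, ht2⟩ : ∃ t : ℝ, 0 < t ∧ t ≤ y v ∧ t * A < A - D := by
    refine ⟨min (y v) ((A - D) / (2 * A)), by positivity, min_le_left _ _, ?_⟩
    have := min_le_right (y v) ((A - D) / (2 * A))
    calc _ ≤ (A - D) / (2 * A) * A := by gcongr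
      _ = (A - D) / 2 := by field_simp
      _ < _ := by linarith
  have := hle t ht0 ht1
  nlinarith

/-- **Motzkin–Straus**: a weighted graph of density above `1 - 1/r` contains an `(r+1)`-clique. -/
theorem exists_isNClique_of_adjForm_gt {r : ℕ} (hr : 1 ≤ r) {y : V → ℝ}
    (hy : ∀ v, 0 ≤ y v) (hy1 : ∑ v, y v = 1) (h : 1 - 1 / (r : ℝ) < G.adjForm y) :
    ∃ K, G.IsNClique (r + 1) K := by
  classical
  have hcont : Continuous G.adjForm := by
    unfold adjForm
    refine continuous_finsetSum _ fun u _ => continuous_finsetSum _ fun w _ => ?_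
    split_ifs <;> fun_prop
  obtain ⟨z, hz, hmax⟩ := (isCompact_stdSimplex ℝ V).exists_isMaxOn ⟨y, hy, hy1⟩ hcont.continuousOn
  have hzd : 1 - 1 / (r : ℝ) < G.adjForm z := h.trans_le (hmax ⟨hy, hy1⟩)
  have hr0 : (0 : ℝ) < r := by exact_mod_cast hr
  have key : ∀ k ≤ r + 1, ∃ K, G.IsNClique k K ∧ ∀ v ∈ K, 0 < z v := by
    intro k
    induction k with
    | zero => exact fun _ => ⟨∅, by simp, by simp⟩
    | succ k ih =>
      intro hk
      obtain ⟨K, hK, hKz⟩ := ih (by omega)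
      have h1 := le_sum_commonNeighborsIn hz.1 hz.2 (G := G) (δ := 1 - G.adjForm z) univ K
        fun v hv => by linarith [le_sum_adj_of_isMaxOn hz hmax (hKz v hv)]
      have h2 : (0 : ℝ) < ∑ w ∈ G.commonNeighborsIn univ K, z w := by
        refine lt_of_lt_of_le ?_ h1
        rw [hz.2, hK.card_eq]
        have h3 : (k : ℝ) ≤ r := by exact_mod_cast (by omega)
        have h4 : (r : ℝ) * (1 - G.adjForm z) < 1 := by
          calc (r : ℝ) * (1 - G.adjForm z) < r * (1 / r) := by gcongr; linarith
            _ = 1 := by field_simp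
        rcases le_total 0 (1 - G.adjForm z) with h5 | h5
        · nlinarith
        · have : (0 : ℝ) ≤ k := Nat.cast_nonneg _
          nlinarith
      obtain ⟨w, hw, hwz⟩ := exists_lt_of_sum_lt (s := G.commonNeighborsIn univ K)
        (f := fun _ => (0 : ℝ)) (g := z) (by simpa using h2)
      rw [mem_commonNeighborsIn] at hw
      refine ⟨insert w K, hK.insert fun v hv => (hw.2 v hv).symm, ?_⟩
      simp only [mem_insert, forall_eq_or_imp]
      exact ⟨hwz, hKz⟩
  obtain ⟨K, hK, -⟩ := key (r + 1) le_rfl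
  exact ⟨K, hK⟩

/-- Among `r + 1` sets of large total weight, two have a heavy intersection: a point lying in `a`
of the sets is counted `a (a - 1) ≥ 2 (r - 1) a - r (r - 1)` times by ordered pairs. -/
theorem exists_pair_le_sum_inter [DecidableEq V] {y : V → ℝ} (hy : ∀ v, 0 ≤ y v)
    (hy1 : ∑ v, y v = 1)
    {r : ℕ} (hr : 1 ≤ r) {K : Finset V} (hK : K.card = r + 1) (N : V → Finset V) {θ : ℝ}
    (hθ : (r : ℝ) * (r + 1) * θ ≤ 2 * (r - 1) * ∑ v ∈ K, ∑ w ∈ N v, y w - r * (r - 1)) :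
    ∃ u ∈ K, ∃ v ∈ K, u ≠ v ∧ θ ≤ ∑ w ∈ N u ∩ N v, y w := by
  by_contra! hcon
  have hne : K.offDiag.Nonempty := by
    rw [← card_pos, offDiag_card, hK]
    have : r + 1 < (r + 1) * (r + 1) := by nlinarith
    omega
  have hlt : ∑ p ∈ K.offDiag, ∑ w ∈ N p.1 ∩ N p.2, y w < r * (r + 1) * θ := by
    have h1 : ∑ p ∈ K.offDiag, ∑ w ∈ N p.1 ∩ N p.2, y w < ∑ p ∈ K.offDiag, θ := by
      refine sum_lt_sum_of_nonempty hne fun p hp => ?_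
      rw [mem_offDiag] at hp
      exact hcon _ hp.1 _ hp.2.1 hp.2.2
    refine h1.trans_eq ?_
    rw [sum_const, offDiag_card, hK, nsmul_eq_mul]
    have : (r + 1) * (r + 1) - (r + 1) = r * (r + 1) := by
      rw [Nat.sub_eq_iff_eq_add (by nlinarith)]; ring
    rw [this]; push_cast; ring
  let a : V → ℝ := fun w => ∑ v ∈ K, if w ∈ N v then 1 else 0
  have h2 : ∑ v ∈ K, ∑ w ∈ N v, y w = ∑ w, a w * y w := by
    simp only [a, sum_mul, ite_mul, one_mul, zero_mul]
    rw [sum_comm]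
    refine sum_congr rfl fun v _ => ?_
    rw [← sum_filter]; simp
  have h3 : ∑ p ∈ K.offDiag, ∑ w ∈ N p.1 ∩ N p.2, y w = ∑ w, (a w ^ 2 - a w) * y w := by
    have h4 : ∀ w, a w ^ 2 - a w = ∑ p ∈ K.offDiag, if w ∈ N p.1 ∩ N p.2 then 1 else 0 := by
      intro w
      have h5 : a w ^ 2 = ∑ p ∈ K ×ˢ K, if w ∈ N p.1 ∩ N p.2 then 1 else 0 := by
        simp only [a, sq, sum_mul_sum, sum_product, mem_inter, ite_and]
        refine sum_congr rfl fun u _ => sum_congr rfl fun v _ => ?_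
        split_ifs <;> simp
      have h6 : a w = ∑ p ∈ K.diag, if w ∈ N p.1 ∩ N p.2 then 1 else 0 := by
        rw [sum_diag]; simp [a]
      rw [h5, ← diag_union_offDiag, sum_union (disjoint_diag_offDiag K), ← h6]
      ring
    simp only [h4, sum_mul, ite_mul, one_mul, zero_mul]
    rw [sum_comm]
    refine sum_congr rfl fun p _ => ?_
    rw [← sum_filter, filter_mem_eq_inter, univ_inter]
  have h7 : ∑ w, (2 * (r - 1) * a w - r * (r - 1)) * y w ≤ ∑ w, (a w ^ 2 - a w) * y w := by
    refine sum_le_sum fun w _ => mul_le_mul_of_nonneg_right ?_ (hy w)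
    have h8 : a w = ((#{v ∈ K | w ∈ N v} : ℤ) : ℝ) := by simp [a]
    rw [h8]
    generalize (#{v ∈ K | w ∈ N v} : ℤ) = n
    have h9 : (0 : ℤ) ≤ (n - r) * (n - r + 1) := by
      rcases lt_or_ge n r with h | h
      · exact mul_nonneg_of_nonpos_of_nonpos (by omega) (by omega)
      · exact mul_nonneg (by omega) (by omega)
    have h10 : (0 : ℝ) ≤ ((n : ℝ) - r) * (n - r + 1) := by exact_mod_cast h9
    nlinarith
  have h11 : ∑ w, (2 * (r - 1) * a w - r * (r - 1)) * y w =
      2 * (r - 1) * ∑ w, a w * y w - r * (r - 1) := by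
    simp_rw [sub_mul, sum_sub_distrib, mul_assoc, ← mul_sum, hy1, mul_one]
  rw [h2, ← h11] at hθ
  rw [h3] at hlt
  linarith

open Classical in
/-- Greedy counting of cliques: if every clique of fewer than `k` vertices in `S` extends within
`S` in at least `M` ways, then `S` contains at least `M ^ k / k!` cliques of size `k`. -/
theorem pow_le_factorial_mul_card_cliques (S : Finset V) (M : ℕ) (k : ℕ)
    (h : ∀ K ⊆ S, G.IsClique K → K.card < k → M ≤ (G.commonNeighborsIn S K).card) :
    M ^ k ≤ k.factorial * ((S.powersetCard k).filter fun K : Finset V => G.IsClique (K : Set V)).card := by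
  induction k with
  | zero => simp [powersetCard_zero, filter_singleton]
  | succ k ih =>
    have ih := ih fun K hK hc hk => h K hK hc (by omega)
    have h1 : ((S.powersetCard k).filter fun K : Finset V => G.IsClique (K : Set V)).card * M ≤
        ((S.powersetCard (k + 1)).filter fun K : Finset V => G.IsClique (K : Set V)).card * (k + 1) := by
      refine card_mul_le_card_mul (fun K K' => K ⊆ K') ?_ ?_
      · intro K hK
        rw [mem_filter, mem_powersetCard] at hK
        obtain ⟨⟨hKS, hKk⟩, hKc⟩ := hK
        refine (h K hKS hKc (by omega)).trans ?_
        have hnot : ∀ w ∈ G.commonNeighborsIn S K, w ∉ K := fun w hw hwK =>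
          ((mem_commonNeighborsIn.1 hw).2 w hwK).ne rfl
        refine card_le_card_of_injOn (fun w => insert w K) ?_ ?_
        · intro w hw
          have hw' := mem_commonNeighborsIn.1 hw
          rw [mem_coe, mem_bipartiteAbove, mem_filter, mem_powersetCard]
          refine ⟨⟨⟨insert_subset hw'.1 hKS, ?_⟩, ?_⟩, subset_insert _ _⟩
          · rw [card_insert_of_notMem (hnot w hw), hKk]
          · rw [coe_insert, isClique_insert]
            exact ⟨hKc, fun v hv _ => (hw'.2 v hv).symm⟩
        · intro w hw w' hw' heq
          have heq : insert w K = insert w' K := heq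
          have : w ∈ insert w' K := heq ▸ mem_insert_self w K
          exact (mem_insert.1 this).resolve_right (hnot w hw)
      · intro K' hK'
        rw [mem_filter, mem_powersetCard] at hK'
        have hsub : bipartiteBelow (fun K K' => K ⊆ K')
            ((S.powersetCard k).filter fun K : Finset V => G.IsClique (K : Set V)) K' ⊆ K'.powersetCard k := by
          intro K hK
          rw [mem_bipartiteBelow, mem_filter, mem_powersetCard] at hK
          exact mem_powersetCard.2 ⟨hK.2, hK.1.1.2⟩
        refine (card_le_card hsub).trans ?_
        rw [card_powersetCard, hK'.1.2]
        simp
    calc M ^ (k + 1) = M ^ k * M := pow_succ _ _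
      _ ≤ k.factorial * ((S.powersetCard k).filter fun K : Finset V => G.IsClique (K : Set V)).card * M := by gcongr
      _ = k.factorial * (((S.powersetCard k).filter fun K : Finset V => G.IsClique (K : Set V)).card * M) := by ring
      _ ≤ k.factorial * (((S.powersetCard (k + 1)).filter fun K : Finset V => G.IsClique (K : Set V)).card * (k + 1)) := by gcongr
      _ = _ := by rw [Nat.factorial_succ]; ring

end SimpleGraph

namespace SimpleGraph

open Finset Matrix

/-! ### Joints in edge-critical graphs -/

variable {V : Type*} [Fintype V] {H : SimpleGraph V} {x : V → ℝ}

/-- The data shared by the lemmas of this section: an edge-critical graph `H` above the threshold,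
with its Perron vector. The parameter `η` is the tolerance in weighted degrees; its value makes the
codegree gain of `exists_adj_le_codegree` exceed the at most `r - 2` losses of size `η` in the greedy
count. The exponent `1 - η / 4` is close enough to `1` for the loss in each degree estimate to stay
below `η`. -/
structure IsCriticalSetup (H : SimpleGraph V) (x : V → ℝ) (r : ℕ) (η : ℝ) : Prop where
  two_le : 2 ≤ r
  eta_eq : (r : ℝ) ^ 3 * (r + 1) * η = 1
  crit : H.IsEdgeCritical (1 - η / 4)
  perron : H.IsPerronVector x
  ncard_pos : 0 < H.edgeSet.ncard
  lt : (1 - 1 / (r : ℝ)) * (2 * H.edgeSet.ncard) < H.largestEigenvalue ^ 2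

/-- The light neighbourhoods used below: `x v * x w ≤ (8 / η) / √m`. -/
noncomputable abbrev lightNbr (H : SimpleGraph V) (x : V → ℝ) (η : ℝ) (v : V) : Finset V :=
  H.lightNeighbors x (8 / η / √H.edgeSet.ncard) v

namespace IsCriticalSetup

variable {r : ℕ} {η : ℝ}

theorem two_le_cast (h : H.IsCriticalSetup x r η) : (2 : ℝ) ≤ r := by exact_mod_cast h.two_le

theorem eta_pos (h : H.IsCriticalSetup x r η) : 0 < η := by
  have h2 := h.two_le_cast
  have h3 := h.eta_eq
  by_contra! h0
  have : (r : ℝ) ^ 3 * (r + 1) * η ≤ 0 := mul_nonpos_of_nonneg_of_nonpos (by positivity) h0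
  linarith

theorem eta_le (h : H.IsCriticalSetup x r η) {s : ℕ} (hs : s ≤ r) :
    (s : ℝ) ^ 3 * (s + 1) * η ≤ 1 := by
  have hs' : (s : ℝ) ≤ r := by exact_mod_cast hs
  have := h.eta_pos
  refine le_trans ?_ h.eta_eq.le
  gcongr

theorem eta_le_one_div (h : H.IsCriticalSetup x r η) : η ≤ 1 / 24 := by
  have := h.eta_le h.two_le
  norm_num at this
  linarith

theorem half_le (h : H.IsCriticalSetup x r η) : 1 / 2 ≤ 1 - 1 / (r : ℝ) := by
  have : 1 / (r : ℝ) ≤ 1 / 2 := one_div_le_one_div_of_le two_pos h.two_le_cast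
  linarith

theorem ncard_pos' (h : H.IsCriticalSetup x r η) : (0 : ℝ) < H.edgeSet.ncard := by
  exact_mod_cast h.ncard_pos

theorem largestEigenvalue_pos (h : H.IsCriticalSetup x r η) : 0 < H.largestEigenvalue := by
  have h1 := h.half_le
  have h2 := h.ncard_pos'
  have h3 := h.lt
  rcases H.largestEigenvalue_nonneg.eq_or_lt with h4 | h4
  · rw [← h4] at h3
    nlinarith
  · exact h4

theorem sqrt_le (h : H.IsCriticalSetup x r η) : √H.edgeSet.ncard ≤ H.largestEigenvalue := by
  rw [Real.sqrt_le_left h.largestEigenvalue_pos.le]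
  nlinarith [h.half_le, h.ncard_pos', h.lt]

theorem one_le_mul_of_adj (h : H.IsCriticalSetup x r η) {u w : V} (huw : H.Adj u w) :
    1 ≤ 8 * √H.edgeSet.ncard * (x u * x w) := by
  have h0 := h.eta_pos
  have h1 := h.eta_le_one_div
  have h2 := h.crit.le_mul_of_adj (by linarith) (by linarith) h.perron h.largestEigenvalue_pos huw
  have h3 := h.sqrt_le
  have h4 : 0 < √(H.edgeSet.ncard : ℝ) := Real.sqrt_pos.2 h.ncard_pos'
  have h5 : (H.edgeSet.ncard : ℝ) = √H.edgeSet.ncard * √H.edgeSet.ncard :=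
    (Real.mul_self_sqrt h.ncard_pos'.le).symm
  set s := √(H.edgeSet.ncard : ℝ)
  rw [h5] at h2
  have h6 : 1 / 2 * s ≤ 4 * s * (x u * x w) * s := by nlinarith
  have := le_of_mul_le_mul_right h6 h4
  linarith

theorem pos_of_adj (h : H.IsCriticalSetup x r η) {u w : V} (huw : H.Adj u w) : 0 < x u := by
  rcases (h.perron.nonneg u).eq_or_lt with h1 | h1
  · have := h.one_le_mul_of_adj huw
    rw [← h1] at this
    norm_num at this
  · exact h1

theorem le_lightNbr (h : H.IsCriticalSetup x r η) {v : V} (hv : 0 < x v) :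
    (1 - η / 2) * (1 - 1 / (r : ℝ)) * (2 * (1 - x v ^ 2) ^ 2) ≤
      (∑ w ∈ H.lightNbr x η v, x w ^ 2) * (2 - 3 * x v ^ 2) := by
  have h0 := h.eta_pos
  have h1 := h.eta_le_one_div
  have h2 := h.half_le
  refine le_trans ?_ (h.crit.le_sum_sq_lightNeighbors (by linarith) (by linarith) h.perron
    h.ncard_pos h.half_le h.largestEigenvalue_pos h.lt.le (L := 8 / η) ?_ hv)
  · have h3 : (1 - η / 2) ≤ (1 - η / 4) * (1 - 1 / (8 / η)) ^ 2 := by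
      rw [one_div_div]
      nlinarith [mul_pos h0 h0, mul_pos (mul_pos h0 h0) h0]
    gcongr
  · rw [le_div_iff₀ h0]; linarith

/-- A lower bound valid for all vertices, however large their Perron weight:
`2 (1 - y)² / (2 - 3 y) ≥ 8 / 9`, with equality for `y = 1 / 3`. -/
theorem eight_ninths_le_lightNbr (h : H.IsCriticalSetup x r η) {v : V} (hv : 0 < x v) :
    8 / 9 * ((1 - η / 2) * (1 - 1 / (r : ℝ))) ≤ ∑ w ∈ H.lightNbr x η v, x w ^ 2 := by
  have h1 := h.le_lightNbr hv
  have h2 := h.perron.sq_le_half h.largestEigenvalue_pos v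
  set y := x v ^ 2
  have h3 : 0 < 2 - 3 * y := by linarith
  have h4 : 0 ≤ (1 - η / 2) * (1 - 1 / (r : ℝ)) :=
    mul_nonneg (by linarith [h.eta_le_one_div]) (by linarith [h.half_le])
  refine le_of_mul_le_mul_right (le_trans ?_ h1) h3
  have h5 : 8 / 9 * (2 - 3 * y) ≤ 2 * (1 - y) ^ 2 := by nlinarith [sq_nonneg (3 * y - 1)]
  calc _ = (1 - η / 2) * (1 - 1 / (r : ℝ)) * (8 / 9 * (2 - 3 * y)) := by ring
    _ ≤ _ := by gcongr

/-- Vertices of small Perron weight have almost the extremal weighted degree. -/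
theorem le_lightNbr_of_sq_le (h : H.IsCriticalSetup x r η) {v : V} (hv : 0 < x v)
    (hvη : x v ^ 2 ≤ η / 4) :
    1 - 1 / (r : ℝ) - η ≤ ∑ w ∈ H.lightNbr x η v, x w ^ 2 := by
  have h1 := h.le_lightNbr hv
  have h0 := h.eta_pos
  have h2 := h.eta_le_one_div
  have h3 := h.half_le
  have hD : 0 ≤ ∑ w ∈ H.lightNbr x η v, x w ^ 2 := sum_nonneg fun w _ => sq_nonneg _
  have hy : 0 < x v ^ 2 := by positivity
  set y := x v ^ 2
  set D := ∑ w ∈ H.lightNbr x η v, x w ^ 2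
  have h4 : (1 - η / 2) * (1 - 1 / (r : ℝ)) * (1 - y) * (2 * (1 - y)) ≤ D * (2 * (1 - y)) := by
    nlinarith
  have h5 := le_of_mul_le_mul_right h4 (by linarith)
  refine le_trans ?_ h5
  have h6 : 1 - 1 / (r : ℝ) ≤ 1 := by
    have : 0 ≤ 1 / (r : ℝ) := by positivity
    linarith
  have h7 : 1 - η ≤ (1 - η / 2) * (1 - y) := by nlinarith
  nlinarith

/-- For `r ≥ 3` and large `m` no vertex has large Perron weight: the light neighbourhood of such a
vertex would be an independent set of weight more than `1 / 2`, leaving too little weight for the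
neighbourhoods of its own members. -/
theorem sq_le_of_three_le (h : H.IsCriticalSetup x r η) (hr : 3 ≤ r)
    (hm : 8 * (8 / η) ^ 2 / (η / 4) < √H.edgeSet.ncard) {v : V} (hv : 0 < x v) :
    x v ^ 2 ≤ η / 4 := by
  classical
  by_contra! hlt
  have h0 := h.eta_pos
  have hs : 0 < √(H.edgeSet.ncard : ℝ) := Real.sqrt_pos.2 h.ncard_pos'
  have hη : η ≤ 1 / 108 := by
    have := h.eta_le hr
    norm_num at this
    linarith
  have hρ : 2 / 3 ≤ 1 - 1 / (r : ℝ) := by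
    have : 1 / (r : ℝ) ≤ 1 / 3 := one_div_le_one_div_of_le (by norm_num) (by exact_mod_cast hr)
    linarith
  have hhalf : ∀ w, 0 < x w → 1 / 2 < ∑ w' ∈ H.lightNbr x η w, x w' ^ 2 := fun w hw => by
    refine lt_of_lt_of_le ?_ (h.eight_ninths_le_lightNbr hw)
    nlinarith
  have hindep : ∀ w ∈ H.lightNbr x η v, ∀ w' ∈ H.lightNbr x η v, ¬ H.Adj w w' := by
    intro w hw w' hw' hadj
    have h1 := (mem_lightNeighbors.1 hw).2
    have h2 := (mem_lightNeighbors.1 hw').2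
    have h3 := h.one_le_mul_of_adj hadj
    have hxw := h.perron.nonneg w
    have hxw' := h.perron.nonneg w'
    have h4 := mul_le_mul h1 h2 (by positivity) (by positivity)
    rw [div_lt_iff₀ (by positivity)] at hm
    set s := √(H.edgeSet.ncard : ℝ)
    set L := 8 / η
    have h5 : (η / 4) * (x w * x w') ≤ L / s * (L / s) := by
      refine le_trans ?_ h4
      nlinarith [mul_nonneg hxw hxw']
    have h6 : η / 4 * s ≤ 8 * L ^ 2 := by
      calc η / 4 * s ≤ η / 4 * s * (8 * s * (x w * x w')) :=
            le_mul_of_one_le_right (by positivity) h3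
        _ = 8 * s ^ 2 * (η / 4 * (x w * x w')) := by ring
        _ ≤ 8 * s ^ 2 * (L / s * (L / s)) := by gcongr
        _ = 8 * L ^ 2 := by field_simp
    linarith
  have hv2 := hhalf v hv
  obtain ⟨w, hw⟩ : (H.lightNbr x η v).Nonempty := by
    by_contra hne
    rw [not_nonempty_iff_eq_empty] at hne
    rw [hne, sum_empty] at hv2
    linarith
  have hw2 := hhalf w (h.pos_of_adj (mem_lightNeighbors.1 hw).1.symm)
  have hdisj : Disjoint (H.lightNbr x η v) (H.lightNbr x η w) := by
    rw [Finset.disjoint_left]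
    exact fun w' hw' hw'' => hindep w hw w' hw' (mem_lightNeighbors.1 hw'').1
  have hsum : ∑ w' ∈ H.lightNbr x η v ∪ H.lightNbr x η w, x w' ^ 2 ≤ 1 := by
    rw [← h.perron.sum_sq]
    exact sum_le_sum_of_subset_of_nonneg (subset_univ _) fun _ _ _ => sq_nonneg _
  rw [sum_union hdisj] at hsum
  linarith

theorem exists_isNClique (h : H.IsCriticalSetup x r η) : ∃ K, H.IsNClique (r + 1) K := by
  refine exists_isNClique_of_adjForm_gt (by linarith [h.two_le]) (y := fun v => x v ^ 2)
    (fun v => sq_nonneg _) h.perron.sum_sq ?_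
  have h1 := H.adjForm_sq_le x
  rw [h.perron.adjForm_eq] at h1
  have h2 := h.lt.trans_le h1
  have h3 := h.ncard_pos'
  have h4 : (1 - 1 / (r : ℝ)) * (2 * H.edgeSet.ncard) <
      H.adjForm (fun v => x v ^ 2) * (2 * H.edgeSet.ncard) := by linarith
  exact lt_of_mul_lt_mul_right h4 (by positivity)

/-- Some edge has a light codegree exceeding by a constant the value `1 - 2 / r` of the balanced
complete `r`-partite graph. -/
theorem exists_adj_le_codegree [DecidableEq V] (h : H.IsCriticalSetup x r η)
    (hm : 8 * (8 / η) ^ 2 / (η / 4) < √H.edgeSet.ncard) :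
    ∃ u v, H.Adj u v ∧ 1 - 2 / (r : ℝ) + 2 * (r - 1) * η ≤
      ∑ w ∈ H.lightNbr x η u ∩ H.lightNbr x η v, x w ^ 2 := by
  obtain ⟨K, hK⟩ := h.exists_isNClique
  have hr2 := h.two_le_cast
  have h0 := h.eta_pos
  have hpos : ∀ v ∈ K, 0 < x v := by
    intro v hv
    obtain ⟨w, hw, hne⟩ := exists_mem_ne (s := K) (by rw [hK.card_eq]; have := h.two_le; omega) v
    exact h.pos_of_adj (hK.isClique hv hw hne.symm)
  obtain ⟨u, hu, v, hv, huv, hθ⟩ := exists_pair_le_sum_inter (y := fun v => x v ^ 2)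
    (fun v => sq_nonneg _) h.perron.sum_sq (by linarith [h.two_le] : 1 ≤ r) hK.card_eq
    (H.lightNbr x η) (θ := 1 - 2 / (r : ℝ) + 2 * (r - 1) * η) (by
      rcases h.two_le.eq_or_lt with h2 | h3
      · have hη := h.eta_eq
        have h4 : (K.card : ℝ) * (8 / 9 * ((1 - η / 2) * (1 - 1 / (r : ℝ)))) ≤
            ∑ v ∈ K, ∑ w ∈ H.lightNbr x η v, x w ^ 2 := by
          rw [← nsmul_eq_mul]
          exact card_nsmul_le_sum _ _ _ fun v hv => h.eight_ninths_le_lightNbr (hpos v hv)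
        rw [hK.card_eq] at h4
        subst h2
        norm_num at h4 hη ⊢
        linarith
      · have h4 : (K.card : ℝ) * (1 - 1 / (r : ℝ) - η) ≤
            ∑ v ∈ K, ∑ w ∈ H.lightNbr x η v, x w ^ 2 := by
          rw [← nsmul_eq_mul]
          exact card_nsmul_le_sum _ _ _ fun v hv =>
            h.le_lightNbr_of_sq_le (hpos v hv) (h.sq_le_of_three_le h3 hm (hpos v hv))
        rw [hK.card_eq] at h4
        push_cast at h4
        have h5 : 2 * ((r : ℝ) - 1) * (((r : ℝ) + 1) * (1 - 1 / (r : ℝ) - η)) ≤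
            2 * (r - 1) * ∑ v ∈ K, ∑ w ∈ H.lightNbr x η v, x w ^ 2 := by
          gcongr
          linarith
        refine le_trans ?_ (sub_le_sub_right h5 _)
        have hr0 : (r : ℝ) ≠ 0 := by linarith
        have h6 : 2 * ((r : ℝ) - 1) * (((r : ℝ) + 1) * (1 - 1 / (r : ℝ) - η)) - r * (r - 1) -
            (r : ℝ) * (r + 1) * (1 - 2 / (r : ℝ) + 2 * (r - 1) * η) =
            2 / r * (1 - (r + 1) * (r - 1) * (r + r ^ 2) * η) := by
          field_simp
          ring
        have h7 : ((r : ℝ) + 1) * (r - 1) * (r + r ^ 2) * η ≤ (r : ℝ) ^ 3 * (r + 1) * η := by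
          have h8 : 0 ≤ (r : ℝ) * (r + 1) * η := by positivity
          linarith
        have h8 : 0 ≤ 2 / (r : ℝ) * (1 - (r + 1) * (r - 1) * (r + r ^ 2) * η) := by
          rw [h.eta_eq] at h7
          exact mul_nonneg (by positivity) (by linarith)
        linarith)
  exact ⟨u, v, hK.isClique hu hv huv, hθ⟩

/-- The common light neighbours of two adjacent vertices have Perron weight `O(m ^ (-1/2))`. -/
theorem sq_mul_sqrt_le [DecidableEq V] (h : H.IsCriticalSetup x r η) {u v w : V}
    (huv : H.Adj u v) (hw : w ∈ H.lightNbr x η u ∩ H.lightNbr x η v) :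
    x w ^ 2 * √H.edgeSet.ncard ≤ 8 * (8 / η) ^ 2 := by
  rw [mem_inter] at hw
  have h0 := h.eta_pos
  have hs : 0 < √(H.edgeSet.ncard : ℝ) := Real.sqrt_pos.2 h.ncard_pos'
  have h1 := (mem_lightNeighbors.1 hw.1).2
  have h2 := (mem_lightNeighbors.1 hw.2).2
  have h3 := h.one_le_mul_of_adj huv
  have hxw := h.perron.nonneg w
  have hxv := h.perron.nonneg v
  have h4 := mul_le_mul h1 h2 (by positivity) (by positivity)
  set s := √(H.edgeSet.ncard : ℝ)
  set L := 8 / η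
  calc x w ^ 2 * s ≤ x w ^ 2 * s * (8 * s * (x u * x v)) :=
        le_mul_of_one_le_right (by positivity) h3
    _ = 8 * s ^ 2 * (x u * x w * (x v * x w)) := by ring
    _ ≤ 8 * s ^ 2 * (L / s * (L / s)) := by gcongr
    _ = 8 * L ^ 2 := by field_simp

/-- The lower bound for the joint size, obtained by greedily building `(r - 1)`-cliques among the
common light neighbours of an edge of large codegree. -/
theorem pow_le_jointSize (h : H.IsCriticalSetup x r η)
    (hm : 8 * (8 / η) ^ 2 / (η / 4) < √H.edgeSet.ncard) {G : SimpleGraph V} (hHG : H ≤ G) :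
    (η / (8 * (8 / η) ^ 2) * √H.edgeSet.ncard) ^ (r - 1) ≤
      (r - 1).factorial * (G.jointSize (r + 1) : ℝ) := by
  classical
  obtain ⟨u, v, huv, hcod⟩ := h.exists_adj_le_codegree hm
  have h0 := h.eta_pos
  have hr2 := h.two_le_cast
  have hs : 0 < √(H.edgeSet.ncard : ℝ) := Real.sqrt_pos.2 h.ncard_pos'
  set S := H.lightNbr x η u ∩ H.lightNbr x η v with hS
  set B := 8 * (8 / η) ^ 2 with hB
  have hBpos : 0 < B := by positivity
  set s := √(H.edgeSet.ncard : ℝ) with hsdef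
  have hSu : ∀ w ∈ S, H.Adj u w := fun w hw => (mem_lightNeighbors.1 (mem_inter.1 hw).1).1
  have hSv : ∀ w ∈ S, H.Adj v w := fun w hw => (mem_lightNeighbors.1 (mem_inter.1 hw).2).1
  have hdeg : ∀ w ∈ S, 1 - (1 / (r : ℝ) + η) ≤ ∑ z, if H.Adj w z then x z ^ 2 else 0 := by
    intro w hw
    have h1 : x w ^ 2 ≤ η / 4 := by
      have h2 := h.sq_mul_sqrt_le huv hw
      rw [div_lt_iff₀ (by positivity)] at hm
      have h3 : x w ^ 2 * s ≤ η / 4 * s := by linarith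
      exact le_of_mul_le_mul_right h3 hs
    have h2 := h.le_lightNbr_of_sq_le (h.pos_of_adj (hSu w hw).symm) h1
    rw [← sum_filter]
    refine le_trans (by linarith) (h2.trans ?_)
    refine sum_le_sum_of_subset_of_nonneg ?_ fun _ _ _ => sq_nonneg _
    intro z hz
    simpa using (mem_lightNeighbors.1 hz).1
  have hcount := pow_le_factorial_mul_card_cliques (G := H) S ⌈η / B * s⌉₊ (r - 1) (by
    intro K hKS _ hKr
    refine Nat.ceil_le.2 ?_
    have h1 := le_sum_commonNeighborsIn (G := H) (y := fun v => x v ^ 2) (fun v => sq_nonneg _)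
      h.perron.sum_sq S K fun w hw => hdeg w (hKS hw)
    have h2 : (K.card : ℝ) ≤ r - 2 := by
      have : K.card + 2 ≤ r := by omega
      have : (K.card : ℝ) + 2 ≤ r := by exact_mod_cast this
      linarith
    have h3 : (K.card : ℝ) * (1 / r + η) ≤ (r - 2) * (1 / r + η) := by gcongr
    have h4 : ((r : ℝ) - 2) * (1 / r + η) = 1 - 2 / r + (r - 2) * η := by
      field_simp
    have h5 : η ≤ ∑ w ∈ H.commonNeighborsIn S K, x w ^ 2 := by nlinarith
    have h6 : (∑ w ∈ H.commonNeighborsIn S K, x w ^ 2) * s ≤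
        (H.commonNeighborsIn S K).card * B := by
      rw [sum_mul, ← nsmul_eq_mul]
      refine sum_le_card_nsmul _ _ _ fun w hw => ?_
      exact h.sq_mul_sqrt_le huv (mem_commonNeighborsIn.1 hw).1
    rw [div_mul_eq_mul_div, div_le_iff₀ hBpos]
    exact (mul_le_mul_of_nonneg_right h5 hs.le).trans h6)
  set Q := (S.powersetCard (r - 1)).filter fun K : Finset V => H.IsClique (K : Set V) with hQ
  -- adding `u` and `v` to the cliques found in `S` gives a joint
  have hQmem : ∀ K ∈ Q, K ⊆ S ∧ K.card = r - 1 ∧ H.IsClique (K : Set V) := by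
    intro K hK
    rw [hQ, mem_filter, mem_powersetCard] at hK
    exact ⟨hK.1.1, hK.1.2, hK.2⟩
  have huS : u ∉ S := fun hu => (hSu u hu).ne rfl
  have hvS : v ∉ S := fun hv => (hSv v hv).ne rfl
  have hjoint : G.IsJoint (r + 1) (Q.image fun K => insert u (insert v K)) := by
    refine ⟨u, v, hHG huv, ?_⟩
    intro K' hK'
    obtain ⟨K, hK, rfl⟩ := mem_image.1 hK'
    obtain ⟨hKS, hKc, hKcl⟩ := hQmem K hK
    refine ⟨?_, by simp, by simp⟩
    have h1 : H.IsNClique (r - 1) K := ⟨hKcl, hKc⟩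
    have h2 := (h1.insert fun w hw => hSv w (hKS hw)).insert (a := u) (by
      intro w hw
      rcases mem_insert.1 hw with rfl | hw
      · exact huv
      · exact hSu w (hKS hw))
    have h3 : r - 1 + 1 + 1 = r + 1 := by have := h.two_le; omega
    rw [h3] at h2
    exact h2.mono hHG
  have hcard : (Q.image fun K => insert u (insert v K)).card = Q.card := by
    refine card_image_of_injOn ?_
    intro K hK K' hK' heq
    have hK := (hQmem K hK).1
    have hK' := (hQmem K' hK').1
    have heq : insert u (insert v K) = insert u (insert v K') := heq
    have h1 : ∀ K ⊆ S, ((insert u (insert v K)).erase u).erase v = K := by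
      intro K hK
      rw [erase_insert, erase_insert fun hv => hvS (hK hv)]
      rw [mem_insert, not_or]
      exact ⟨huv.ne, fun hu => huS (hK hu)⟩
    rw [← h1 K hK, heq, h1 K' hK']
  have hle := hjoint.card_le_jointSize
  rw [hcard] at hle
  calc (η / B * s) ^ (r - 1) ≤ (⌈η / B * s⌉₊ : ℝ) ^ (r - 1) := by
        gcongr; exact Nat.le_ceil _
    _ ≤ ((r - 1).factorial * Q.card : ℕ) := by exact_mod_cast hcount
    _ ≤ ((r - 1).factorial * G.jointSize (r + 1) : ℕ) := by gcongr
    _ = _ := by push_cast; ring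

end IsCriticalSetup

end SimpleGraph

/-! ### The two bounds -/

namespace SimpleGraph

theorem exists_mul_rpow_le_jointSize {r : ℕ} (hr : 2 ≤ r) :
    ∃ c : ℝ, 0 < c ∧ ∀ (V : Type*) [Fintype V] (G : SimpleGraph V),
      (1 - 1 / (r : ℝ)) * (2 * (G.edgeSet.ncard : ℝ)) < G.largestEigenvalue ^ 2 →
      c * (G.edgeSet.ncard : ℝ) ^ (((r : ℝ) - 1) / 2) ≤ (G.jointSize (r + 1) : ℝ) := by
  have hr2 : (2 : ℝ) ≤ r := by exact_mod_cast hr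
  set η : ℝ := 1 / ((r : ℝ) ^ 3 * (r + 1)) with hη
  have hη0 : 0 < η := by positivity
  have hη1 : (r : ℝ) ^ 3 * (r + 1) * η = 1 := by rw [hη]; field_simp
  have hη2 : η ≤ 1 := by
    rw [hη, div_le_one (by positivity)]
    have : (1 : ℝ) ≤ (r : ℝ) ^ 3 := one_le_pow₀ (by linarith)
    nlinarith
  set ρ : ℝ := 1 - 1 / (r : ℝ) with hρ
  have hρ0 : 0 < ρ := by
    have : 1 / (r : ℝ) ≤ 1 / 2 := one_div_le_one_div_of_le two_pos hr2
    rw [hρ]; linarith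
  set κ : ℝ := ρ ^ (1 / (1 - (1 - η / 4))) with hκ
  have hκ0 : 0 < κ := by positivity
  set e : ℝ := ((r : ℝ) - 1) / 2 with he
  have he0 : 0 ≤ e := by rw [he]; linarith
  have hpow : ∀ t : ℝ, 0 ≤ t → √t ^ (r - 1) = t ^ e := by
    intro t ht
    rw [Real.sqrt_eq_rpow, ← Real.rpow_natCast, ← Real.rpow_mul ht, Nat.cast_sub (by omega), he]
    congr 1; push_cast; ring
  -- the number of edges below which the existence of a single clique is enough
  set B : ℝ := (8 * (8 / η) ^ 2 / (η / 4)) ^ 2 / κ with hB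
  have hB0 : 0 < B := by positivity
  set b : ℝ := (η / (8 * (8 / η) ^ 2)) ^ (r - 1) with hb
  have hb0 : 0 < b := by positivity
  refine ⟨min (b * κ ^ e / (r - 1).factorial) (1 / B ^ e), by positivity, ?_⟩
  intro V _ G hG
  obtain ⟨H, hHG, hcrit, hpos, hlt, hκm⟩ := exists_isEdgeCritical G (α := 1 - η / 4) hρ0
    (by linarith) hG
  have hne : Nonempty V := by
    by_contra hne
    rw [not_nonempty_iff] at hne
    rw [show H.largestEigenvalue = 0 by simp [largestEigenvalue]] at hlt
    have : 0 ≤ ρ * (2 * (H.edgeSet.ncard : ℝ)) := by positivity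
    linarith
  obtain ⟨x, hx⟩ := H.exists_isPerronVector
  have hset : H.IsCriticalSetup x r η := ⟨hr, hη1, hcrit, hx, hpos, hlt⟩
  have hm0 : (0 : ℝ) ≤ G.edgeSet.ncard := Nat.cast_nonneg _
  by_cases hm : 8 * (8 / η) ^ 2 / (η / 4) < √H.edgeSet.ncard
  · have h1 := hset.pow_le_jointSize hm hHG
    rw [mul_pow, hpow _ (Nat.cast_nonneg _)] at h1
    have h2 : (κ * G.edgeSet.ncard) ^ e ≤ (H.edgeSet.ncard : ℝ) ^ e :=
      Real.rpow_le_rpow (by positivity) hκm he0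
    rw [Real.mul_rpow hκ0.le hm0] at h2
    have hf : (0 : ℝ) < (r - 1).factorial := by exact_mod_cast Nat.factorial_pos _
    calc _ ≤ b * κ ^ e / (r - 1).factorial * (G.edgeSet.ncard : ℝ) ^ e := by
          gcongr; exact min_le_left _ _
      _ = b * (κ ^ e * (G.edgeSet.ncard : ℝ) ^ e) / (r - 1).factorial := by ring
      _ ≤ b * (H.edgeSet.ncard : ℝ) ^ e / (r - 1).factorial := by gcongr
      _ ≤ _ := by rw [div_le_iff₀ hf]; linarith
  · push Not at hm
    obtain ⟨K, hK⟩ := hset.exists_isNClique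
    have h1 : (1 : ℝ) ≤ G.jointSize (r + 1) := by
      exact_mod_cast (hK.mono hHG).one_le_jointSize (by omega)
    have h2 : (G.edgeSet.ncard : ℝ) ≤ B := by
      rw [hB, le_div_iff₀ hκ0]
      have h3 := (Real.sqrt_le_left (by positivity)).1 hm
      linarith
    refine le_trans ?_ h1
    calc _ ≤ 1 / B ^ e * (G.edgeSet.ncard : ℝ) ^ e := by gcongr; exact min_le_right _ _
      _ ≤ 1 / B ^ e * B ^ e := by gcongr
      _ = 1 := by field_simp

end SimpleGraph

theorem mainTheorem2 (r : ℕ) (hr : 1 ≤ r) :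
    (∃ c : ℝ, 0 < c ∧ ∀ (V : Type*) [Fintype V] (G : SimpleGraph V) (m : ℕ),
      G.edgeSet.ncard = m →
      (1 - 1 / (r : ℝ)) * (2 * (m : ℝ)) < G.largestEigenvalue ^ 2 →
      c * (m : ℝ) ^ (((r : ℝ) - 1) / 2) ≤ (G.jointSize (r + 1) : ℝ)) ∧
    (∃ C : ℝ, 0 < C ∧ ∃ m₀ : ℕ, ∀ m : ℕ, m₀ ≤ m →
      ∃ (n : ℕ) (G : SimpleGraph (Fin n)),
        G.edgeSet.ncard = m ∧
        (1 - 1 / (r : ℝ)) * (2 * (m : ℝ)) < G.largestEigenvalue ^ 2 ∧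
        (G.jointSize (r + 1) : ℝ) ≤ C * (m : ℝ) ^ (((r : ℝ) - 1) / 2)) := by
  constructor
  · rcases hr.eq_or_lt with rfl | hr2
    · -- for `r = 1` the graph has an edge, which is a clique on two vertices
      refine ⟨1, one_pos, ?_⟩
      rintro V _ G m rfl hG
      have hG' : 0 < G.largestEigenvalue ^ 2 := by simpa using hG
      obtain ⟨e, he⟩ : G.edgeSet.Nonempty := by
        rw [Set.nonempty_iff_ne_empty]
        intro h
        rw [SimpleGraph.largestEigenvalue_eq_zero_of_ncard_eq_zero (by simp [h])] at hG'
        simp at hG'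
      induction e with
      | _ u v =>
        classical
        have huv : G.Adj u v := he
        have hK : G.IsNClique 2 {u, v} :=
          ⟨by simp [SimpleGraph.isClique_insert, huv], Finset.card_pair huv.ne⟩
        have := hK.one_le_jointSize le_rfl
        simpa using this
    · obtain ⟨c, hc, h⟩ := SimpleGraph.exists_mul_rpow_le_jointSize hr2
      refine ⟨c, hc, ?_⟩
      rintro V _ G m rfl hG
      exact h V G hG
  · refine ⟨3 ^ (r - 1), by positivity, (9 * r) ^ 2, fun m hm => ?_⟩
    obtain ⟨n, G, hGm, hlt, hn⟩ := SimpleGraph.exists_tight_graph hr hm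
    refine ⟨n, G, hGm, hlt, ?_⟩
    have h1 : (G.jointSize (r + 1) : ℝ) ≤ (n : ℝ) ^ (r - 1) := by
      have := G.jointSize_succ_le hr
      rw [Fintype.card_fin] at this
      exact_mod_cast this
    have h2 : (n : ℝ) ≤ 3 * √m := by
      refine le_of_sq_le_sq ?_ (by positivity)
      rw [mul_pow, Real.sq_sqrt (Nat.cast_nonneg _)]
      linarith
    have h3 : √(m : ℝ) ^ (r - 1) = (m : ℝ) ^ (((r : ℝ) - 1) / 2) := by
      rw [Real.sqrt_eq_rpow, ← Real.rpow_natCast, ← Real.rpow_mul (Nat.cast_nonneg _),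
        Nat.cast_sub hr]
      congr 1; push_cast; ring
    calc _ ≤ (n : ℝ) ^ (r - 1) := h1
      _ ≤ (3 * √m) ^ (r - 1) := by gcongr
      _ = _ := by rw [mul_pow, h3]
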